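/- For positive integers $k,n$ let $\Delta_k=\{x\in[0,1]^k : x_1+\dots+x_k=1\}$ with vertices $e^1,\dots,e^k$, let $\Delta_{k,n}$ be the set of $x\in\Delta_k$ all of whose coordinates are multiples of $1/n$, and let $E_{k,n}$ be the set of unordered pairs $\{x,y\}\subseteq\Delta_{k,n}$ with $\|x-y\|_1=2/n$. For $w:E_{k,n}\to\mathbb R_{\ge 0}$, the value of the canonical LP solution is $\mathrm{LP}_c(w)=\sum_{\{x,y\}\in E_{k,n}}w(x,y)\cdot\frac12\|x-y\|_1$. A $k$-way cut is a map $P:\Delta_{k,n}\to\{1,\dots,k\}$ with $P(e^i)=i$ for all $i$; its cost is $\mathrm{cost}(P,w)=\sum_{\{x,y\}\in E_{k,n}}w(x,y)\,\mathbf 1[P(x)\ne P(y)]$. The integrality gap of $w$ is the minimum of $\mathrm{cost}(P,w)$ over all $k$-way cuts, divided by the optimum of the CKR relaxation, i.e. by the minimum of $\sum_{\{x,y\}\in E_{k,n}}w(x,y)\cdot\frac12\|u(x)-u(y)\|_1$ over all maps $u:\Delta_{k,n}\to\Delta_k$ with $u(e^i)=e^i$ for all $i$. For $n\ge 1$ divisible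 by $3$, put $\rho=\frac1{2n}$ and define $w$ on $E_{3,n}$ as follows. Let $H=\{x\in\Delta_{3,n}: x_1,x_2,x_3\le 2/3\}$ and $T_i=\{x\in\Delta_{3,n}: x_i\ge 2/3\}$. Every edge with both endpoints in $H$ has weight $\rho$. Every other edge has both endpoints in exactly one $T_i$; if it lies on a side of the triangle $\Delta_3$, then it has weight $\left(n\max(x_i,y_i)-\frac{2n}{3}\right)\rho$, where $x,y$ are its endpoints (so along each of the two sides at $e^i$ the weights are $\frac n3\rho,(\frac n3-1)\rho,\dots,\rho$, starting at $e^i$); if it does not lie on a side of $\Delta_3$, then it has weight $0$ when it is parallel to the side opposite $e^i$, and weight $\rho$ otherwise. For $k\ge3$ and $S=\{i_1<i_2<i_3\}\subseteq\{1,\dots,k\}$ let $\bar w_S(x,y)=w\big((x_{i_1},x_{i_2},x_{i_3}),(y_{i_1},y_{i_2},y_{i_3})\big)$ if all nonzero coordinates of $x$ and of $y$ have index in $S$, and $\bar w_S(x,y)=0$ otherwise. Let $\bar w=\binom k3^{-1}\sum_{|S|=3}\bar w_S$. **Lemma.** There is an absolute constant $C>0$ such that the following holds. 1. For every $n\ge1$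 divisible by $3$ and every $k\ge3$, the weights $\bar w:E_{k,n}\to\mathbb R_{\ge 0}$ are nonnegative, satisfy $$\mathrm{LP}_c(\bar w)\le\frac56+\frac Cn,$$ and every $k$-way cut $P$ of $\Delta_{k,n}$ has $$\mathrm{cost}(P,\bar w)\ge 1-C\,\frac nk.$$ 2. Consequently, taking $n=\sqrt k$ up to rounding to a multiple of $3$ gives an integrality gap of $\frac65-O(1/\sqrt k)$: for every $k\ge3$ and every $n\ge1$ divisible by $3$ with $|n-\sqrt k|<3$, the optimum of the CKR relaxation for $\bar w$ is positive and the integrality gap of $\bar w$ is at least $\frac65-\frac C{\sqrt k}$. -/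

import Mathlib

/-! ### Multiway Cut and the CKR relaxation -/

/-- The `ℓ₁`-distance on `ℝ^k`. -/
noncomputable def l1dist {k : ℕ} (a b : Fin k → ℝ) : ℝ := ∑ i, |a i - b i|

theorem l1dist_comm {k : ℕ} (a b : Fin k → ℝ) : l1dist a b = l1dist b a := by
  unfold l1dist
  exact Finset.sum_congr rfl fun i _ => abs_sub_comm _ _

/-- A `k`-way cut: an assignment of the vertices to `k` clusters that puts the `i`-th terminal
in the `i`-th cluster. -/
def IsKWayCut {k : ℕ} {V : Type*} (t : Fin k → V) (P : V → Fin k) : Prop :=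
  ∀ i, P (t i) = i

open scoped Classical in
/-- The cost of `P`: the total weight of the (undirected) edges whose endpoints lie in
different clusters. -/
noncomputable def cutCost {k : ℕ} {V : Type*} [Fintype V] (G : SimpleGraph V) (w : Sym2 V → ℝ)
    (P : V → Fin k) : ℝ :=
  ∑ e ∈ G.edgeFinset, w e * (if (Sym2.map P e).IsDiag then 0 else 1)

/-- The minimum cost of a `k`-way cut. -/
noncomputable def cutOpt {k : ℕ} {V : Type*} [Fintype V] (G : SimpleGraph V) (t : Fin k → V)
    (w : Sym2 V → ℝ) : ℝ :=
  sInf (cutCost G w '' {P : V → Fin k | IsKWayCut t P})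

/-- Feasible solutions of the CKR relaxation: every vertex is sent to a point of the simplex,
and the `i`-th terminal to the `i`-th vertex of the simplex. -/
def IsCKRFeasible {k : ℕ} {V : Type*} (t : Fin k → V) (u : V → Fin k → ℝ) : Prop :=
  (∀ v, u v ∈ stdSimplex ℝ (Fin k)) ∧ ∀ i, u (t i) = Pi.single i 1

/-- `‖u x - u y‖₁ / 2` for an edge `e = {x, y}`. -/
noncomputable def ckrLength {k : ℕ} {V : Type*} (u : V → Fin k → ℝ) : Sym2 V → ℝ :=
  Sym2.lift ⟨fun x y => 1 / 2 * l1dist (u x) (u y), fun x y => congrArg (1 / 2 * ·) (l1dist_comm (u x) (u y))⟩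

open scoped Classical in
/-- The objective value of a solution `u` of the CKR relaxation. -/
noncomputable def ckrValue {k : ℕ} {V : Type*} [Fintype V] (G : SimpleGraph V) (w : Sym2 V → ℝ)
    (u : V → Fin k → ℝ) : ℝ :=
  ∑ e ∈ G.edgeFinset, w e * ckrLength u e

/-- The optimal value of the CKR relaxation. -/
noncomputable def ckrOpt {k : ℕ} {V : Type*} [Fintype V] (G : SimpleGraph V) (t : Fin k → V)
    (w : Sym2 V → ℝ) : ℝ :=
  sInf (ckrValue G w '' {u : V → Fin k → ℝ | IsCKRFeasible t u})

/-- The integrality gap of an instance of Multiway Cut. -/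
noncomputable def integralityGap {k : ℕ} {V : Type*} [Fintype V] (G : SimpleGraph V)
    (t : Fin k → V) (w : Sym2 V → ℝ) : ℝ :=
  cutOpt G t w / ckrOpt G t w

/-! ### The triangular grid -/

/-- The grid `Δ_{k,n}` of the points of the simplex whose coordinates are multiples of `1/n`.
A point is given by the numerators of its coordinates: `x` stands for `(x₁/n, …, x_k/n)`. -/
abbrev Grid (k n : ℕ) : Type := {x : Fin k → ℕ // ∑ i, x i = n}

instance (k n : ℕ) : Fintype (Grid k n) :=
  Fintype.subtype (Finset.piAntidiag Finset.univ n) (by intro x; simp)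

/-- The point of the simplex that `x` stands for. -/
noncomputable def Grid.point {k n : ℕ} (x : Grid k n) : Fin k → ℝ := fun i => (x.1 i : ℝ) / n

theorem Grid.point_injective {k n : ℕ} (hn : 0 < n) :
    Function.Injective (Grid.point : Grid k n → Fin k → ℝ) := by
  intro x y h
  apply Subtype.ext
  funext i
  have hi := congrFun h i
  have hn' : (n : ℝ) ≠ 0 := by positivity
  simp only [Grid.point] at hi
  field_simp at hi
  exact_mod_cast hi

/-- The points that elements of `Grid k n` stand for are exactly the points of the simplex all
of whose coordinates are multiples of `1/n`. -/
theorem Grid.range_point {k n : ℕ} (hn : 0 < n) :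
    Set.range (Grid.point : Grid k n → Fin k → ℝ) =
      {a | a ∈ stdSimplex ℝ (Fin k) ∧ ∀ i, ∃ m : ℤ, a i = m * (1 / (n : ℝ))} := by
  have hn' : (0 : ℝ) < n := by exact_mod_cast hn
  ext a
  constructor
  · rintro ⟨x, rfl⟩
    refine ⟨⟨fun i => by unfold Grid.point; positivity, ?_⟩, fun i => ⟨x.1 i, ?_⟩⟩
    · simp only [Grid.point]
      rw [← Finset.sum_div, div_eq_one_iff_eq hn'.ne']
      exact_mod_cast x.2
    · simp [Grid.point, div_eq_mul_inv]
  · rintro ⟨⟨h0, h1⟩, hm⟩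
    choose m hm using hm
    have hm0 : ∀ i, 0 ≤ m i := by
      intro i
      have h := h0 i
      rw [hm i] at h
      have h2 : (0 : ℝ) ≤ m i := nonneg_of_mul_nonneg_left h (by positivity)
      exact_mod_cast h2
    have hcast : ∀ i, (((m i).toNat : ℕ) : ℝ) = m i := by
      intro i
      have h : (((m i).toNat : ℕ) : ℤ) = m i := Int.toNat_of_nonneg (hm0 i)
      exact_mod_cast h
    refine ⟨⟨fun i => (m i).toNat, ?_⟩, ?_⟩
    · have h : (∑ i, (((m i).toNat : ℕ) : ℝ)) = n := by
        simp only [hm] at h1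
        rw [← Finset.sum_mul] at h1
        simp only [hcast]
        field_simp at h1
        exact h1
      exact_mod_cast h
    · funext i
      simp only [Grid.point, hcast, hm i]
      ring

/-- The vertex `e^i` of the simplex as a grid point; these are the terminals. -/
def Grid.vertex (k n : ℕ) (i : Fin k) : Grid k n := ⟨Pi.single i n, by simp⟩

/-- The graph `(Δ_{k,n}, E_{k,n})`: two distinct points are adjacent when their `ℓ₁`-distance
is `2/n`. -/
def gridGraph (k n : ℕ) : SimpleGraph (Grid k n) where
  Adj x y := x ≠ y ∧ l1dist x.point y.point = 2 / n
  symm := ⟨fun x y h => ⟨h.1.symm, by rw [l1dist_comm]; exact h.2⟩⟩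
  loopless := ⟨fun _ h => h.1 rfl⟩

/-- The value of the canonical LP solution, which sends every grid point to itself. -/
noncomputable def canonicalLP (k n : ℕ) (w : Sym2 (Grid k n) → ℝ) : ℝ :=
  ckrValue (gridGraph k n) w Grid.point

/-! ### The weights -/

/-- The weight of an edge of the triangle as a member of the `i`-th corner triangle
`T_i = {x : x_i ≥ 2/3}`; here `x`, `y` are the numerators of its endpoints, and the weight is
zero if they do not both lie in `T_i`. With `ρ = 1/(2n)`: an edge on a side of the triangle has
weight `(n/3)ρ`, `(n/3 - 1)ρ`, …, `ρ`, in this order from `e^i` on; an edge in the interior has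
weight `0` if it is parallel to the side opposite `e^i`, and `ρ` otherwise. -/
noncomputable def cornerWeight (n : ℕ) (i : Fin 3) (x y : Fin 3 → ℕ) : ℝ :=
  if 2 * n ≤ 3 * x i ∧ 2 * n ≤ 3 * y i then
    if ∃ j, x j = 0 ∧ y j = 0 then
      ((max (x i) (y i) : ℕ) - 2 * (n : ℝ) / 3) * (1 / (2 * (n : ℝ)))
    else if x i = y i then 0
    else 1 / (2 * (n : ℝ))
  else 0

/-- The weight `w(x/n, y/n)` of an edge of `Δ_{3,n}`: it is `ρ = 1/(2n)` in the middle hexagon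
`H = {x : x_i ≤ 2/3 for all i}`, including the border of `H`; every other edge lies in exactly one
corner triangle, which determines its weight. -/
noncomputable def triangleWeight (n : ℕ) (x y : Fin 3 → ℕ) : ℝ :=
  if ∀ i, 3 * x i ≤ 2 * n ∧ 3 * y i ≤ 2 * n then 1 / (2 * (n : ℝ))
  else ∑ i, cornerWeight n i x y

theorem cornerWeight_comm (n : ℕ) (i : Fin 3) (x y : Fin 3 → ℕ) :
    cornerWeight n i x y = cornerWeight n i y x := by
  simp only [cornerWeight, and_comm, max_comm, eq_comm]

theorem triangleWeight_comm (n : ℕ) (x y : Fin 3 → ℕ) :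
    triangleWeight n x y = triangleWeight n y x := by
  simp only [triangleWeight, and_comm, cornerWeight_comm n _ x y]

/-- The support of a grid point. -/
def Grid.supp {k n : ℕ} (x : Grid k n) : Finset (Fin k) := {i | x.1 i ≠ 0}

/-- The triangle weights embedded into the face of `Δ_{k,n}` spanned by the `e^i` with `i ∈ S`,
`S = {i₁ < i₂ < i₃}`: the edge `{x, y}` gets the weight of the edge between
`(x_{i₁}, x_{i₂}, x_{i₃})` and `(y_{i₁}, y_{i₂}, y_{i₃})` if `x` and `y` lie on this face, and
zero otherwise. -/
noncomputable def faceWeight (k n : ℕ) (S : {S : Finset (Fin k) // S.card = 3}) :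
    Sym2 (Grid k n) → ℝ :=
  Sym2.lift ⟨fun x y =>
    if x.supp ⊆ S.1 ∧ y.supp ⊆ S.1 then
      triangleWeight n (fun j => x.1 (S.1.orderEmbOfFin S.2 j))
        (fun j => y.1 (S.1.orderEmbOfFin S.2 j))
    else 0,
    fun x y => by simp only [and_comm, triangleWeight_comm n (fun j => x.1 _)]⟩

/-- The average of the embedded weights over all triangular faces. -/
noncomputable def averageWeight (k n : ℕ) (e : Sym2 (Grid k n)) : ℝ :=
  (∑ S : {S : Finset (Fin k) // S.card = 3}, faceWeight k n S e) / (k.choose 3 : ℝ)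

/-! ### Total variation along the lines of the triangular grid -/

/-! Let n = 3m and measure weights in units of ρ = 1/(2n). The argument takes place on single
triangular faces. Call a face bad if some point of a side is assigned to the opposite terminal. A
bad face is determined by two vertices, a point between them and the label of that point, so there
are at most k²(n+1) bad faces, an O(n/k) fraction of all (`card_opposite_le`). On every other face
the cut costs at least 6m units, which is 1 (`edgeSum_ne_ge`), while the total weight of 15m² + 3m
units gives the canonical value 5/6 + 1/(6m).

The bound of 6m rests on a splitting of the weights (`totalVar_ge`). The weights m, m-1, …, 1 near a
corner are a superposition of segments of lengths 1, …, m. These prolong each line x_i = d with d ≤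
m to a path joining two corners. What remains are the lines x_i = m+d with 1 ≤ d ≤ m and the middle
thirds of the sides.

Given a non-opposite cut, let p ≤ 2m be the largest level whose line x₁ = p carries no label of the
first corner (level 0 qualifies), and define q, r likewise. Take the points with the first label
above level p, their two analogues, and the rest. An uncut edge never leaves its set, and a cut edge
bounds at most two of the four, so the boundaries add up to at most twice the cost. The first corner
set has boundary at least 2(3m-p) (`totalVar_ge_of_corner`). The rest contains the truncated
triangle x₁ ≤ p, x₂ ≤ q, x₃ ≤ r and has boundary at least 2(p+q+r-3m) when this is positive
(`totalVar_ge_of_oneOn`). The sum is at least 12m.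

The gap then follows from comparing with the canonical solution. The relaxation optimum is positive
because a coordinate of any solution must drop from 1 to 0 along the paths. -/

/-- The weight, in units of `1/(2n)` with `n = 3m`, of the edge between `(c, t, n-c-t)` and
`(c, t+1, n-c-t-1)`. -/
def lineWeight (m c t : ℕ) : ℝ :=
  if c = 0 then ((1 + (t - 2 * m) + (m - 1 - t) : ℕ) : ℝ) else if c ≤ 2 * m then 1 else 0

theorem lineWeight_nonneg (m c t : ℕ) : 0 ≤ lineWeight m c t := by
  unfold lineWeight
  split_ifs <;> positivity

/-- Cyclic shift of a function of three coordinates. -/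
def rotate {α : Type*} (f : ℕ → ℕ → ℕ → α) (a b c : ℕ) : α := f c a b

/-- The variation of `f` along the line `x₁ = c` of the grid of size `3m`. -/
def lineVar (m : ℕ) (f : ℕ → ℕ → ℕ → ℝ) (c : ℕ) : ℝ :=
  ∑ t ∈ Finset.range (3 * m - c), |f c t (3 * m - c - t) - f c (t + 1) (3 * m - c - t - 1)|

/-- The weighted variation of `f` along all lines parallel to the side `x₁ = 0`. -/
noncomputable def dirVar (m : ℕ) (f : ℕ → ℕ → ℕ → ℝ) : ℝ :=
  ∑ c ∈ Finset.range (3 * m), ∑ t ∈ Finset.range (3 * m - c),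
    lineWeight m c t * |f c t (3 * m - c - t) - f c (t + 1) (3 * m - c - t - 1)|

/-- The variation along the line `x₁ = d` extended by segments of two sides to a path that
joins two corners. -/
def pathVar (m : ℕ) (f : ℕ → ℕ → ℕ → ℝ) (d : ℕ) : ℝ :=
  lineVar m f d + |f 0 (3 * m) 0 - f d (3 * m - d) 0| + |f 0 0 (3 * m) - f d 0 (3 * m - d)|

/-- A lower bound for the variation on the middle third of the side `x₁ = 0`. -/
def sideVar (m : ℕ) (f : ℕ → ℕ → ℕ → ℝ) : ℝ := |f 0 m (2 * m) - f 0 (2 * m) m|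

/-- The weighted variation of `f` over all edges of the triangular grid. -/
noncomputable def totalVar (m : ℕ) (f : ℕ → ℕ → ℕ → ℝ) : ℝ :=
  dirVar m f + dirVar m (rotate f) + dirVar m (rotate (rotate f))

theorem totalVar_rotate (m : ℕ) (f : ℕ → ℕ → ℕ → ℝ) : totalVar m (rotate f) = totalVar m f := by
  have h : rotate (rotate (rotate f)) = f := rfl
  rw [totalVar, h, totalVar]
  ring

theorem abs_sub_le_sum_range (g : ℕ → ℝ) {a b : ℕ} (hab : a ≤ b) :
    |g a - g b| ≤ ∑ t ∈ Finset.Ico a b, |g t - g (t + 1)| := by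
  simpa [Real.dist_eq] using dist_le_Ico_sum_dist g hab

theorem lineVar_ge (m : ℕ) (f : ℕ → ℕ → ℕ → ℝ) {c t u : ℕ} (h : c + t + u = 3 * m) :
    |f c 0 (3 * m - c) - f c t u| + |f c t u - f c (3 * m - c) 0| ≤ lineVar m f c := by
  have h1 := abs_sub_le_sum_range (fun t => f c t (3 * m - c - t)) (Nat.zero_le t)
  have h2 := abs_sub_le_sum_range (fun t => f c t (3 * m - c - t)) (show t ≤ 3 * m - c by omega)
  have h3 := Finset.sum_Ico_consecutive
    (fun t => |f c t (3 * m - c - t) - f c (t + 1) (3 * m - c - (t + 1))|) (Nat.zero_le t)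
    (show t ≤ 3 * m - c by omega)
  have h4 : 3 * m - c - t = u := by omega
  simp only [Nat.sub_zero, Nat.sub_self, h4] at h1 h2
  rw [lineVar, Finset.range_eq_Ico]
  simp only [Nat.sub_sub, add_assoc] at h1 h2 h3 ⊢
  linarith

theorem lineVar_nonneg (m : ℕ) (f : ℕ → ℕ → ℕ → ℝ) (c : ℕ) : 0 ≤ lineVar m f c :=
  Finset.sum_nonneg fun _ _ => abs_nonneg _

/-- Exchange of summation: t < m is counted once for each d with t < d ≤ m. The number m - t of
these is written as in `lineWeight`. -/
theorem sum_Icc_sum_range (g : ℕ → ℝ) (m : ℕ) :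
    ∑ d ∈ Finset.Icc 1 m, ∑ t ∈ Finset.range d, g t
      = ∑ t ∈ Finset.range m, ((1 + (m - 1 - t) : ℕ) : ℝ) * g t := by
  induction m with
  | zero => simp
  | succ m ih =>
    rw [Finset.sum_Icc_succ_top (by omega), ih, Finset.sum_range_succ, Finset.sum_range_succ,
      ← add_assoc, ← Finset.sum_add_distrib]
    congr 1
    · refine Finset.sum_congr rfl fun t ht => ?_
      have h : (1 + (m + 1 - 1 - t) : ℕ) = (1 + (m - 1 - t)) + 1 := by
        have := Finset.mem_range.1 ht; omega
      rw [h]; push_cast; ring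
    · simp

/-- The weights of a side dominate the paths that run along it from one of its ends for at most
a third of its length. -/
theorem side_ge (m : ℕ) (g : ℕ → ℝ) :
    ∑ d ∈ Finset.Icc 1 m, |g 0 - g d| + ∑ d ∈ Finset.Icc 1 m, |g (3 * m) - g (3 * m - d)|
        + |g m - g (2 * m)|
      ≤ ∑ t ∈ Finset.range (3 * m),
        ((1 + (t - 2 * m) + (m - 1 - t) : ℕ) : ℝ) * |g t - g (t + 1)| := by
  have e1 : ∑ d ∈ Finset.Icc 1 m, |g 0 - g d| ≤
      ∑ t ∈ Finset.Ico 0 m, ((1 + (t - 2 * m) + (m - 1 - t) : ℕ) : ℝ) * |g t - g (t + 1)| := by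
    calc _ ≤ ∑ d ∈ Finset.Icc 1 m, ∑ t ∈ Finset.range d, |g t - g (t + 1)| := by
          refine Finset.sum_le_sum fun d _ => ?_
          rw [Finset.range_eq_Ico]
          exact abs_sub_le_sum_range g (Nat.zero_le d)
      _ = _ := by
          rw [sum_Icc_sum_range, Finset.range_eq_Ico]
          refine Finset.sum_congr rfl fun t ht => ?_
          have h : t - 2 * m = 0 := by have := (Finset.mem_Ico.1 ht).2; omega
          rw [h]
  have e2 : |g m - g (2 * m)| ≤
      ∑ t ∈ Finset.Ico m (2 * m),
        ((1 + (t - 2 * m) + (m - 1 - t) : ℕ) : ℝ) * |g t - g (t + 1)| := by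
    refine (abs_sub_le_sum_range g (by omega)).trans (Finset.sum_le_sum fun t _ => ?_)
    refine le_mul_of_one_le_left (abs_nonneg _) ?_
    push_cast
    have h1 : (0 : ℝ) ≤ ((t - 2 * m : ℕ) : ℝ) := by positivity
    have h2 : (0 : ℝ) ≤ ((m - 1 - t : ℕ) : ℝ) := by positivity
    linarith
  have e3 : ∑ d ∈ Finset.Icc 1 m, |g (3 * m) - g (3 * m - d)| ≤
      ∑ t ∈ Finset.Ico (2 * m) (3 * m),
        ((1 + (t - 2 * m) + (m - 1 - t) : ℕ) : ℝ) * |g t - g (t + 1)| := by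
    have hr : ∀ d ∈ Finset.Icc 1 m, |g (3 * m) - g (3 * m - d)| ≤
        ∑ t ∈ Finset.range d, |g (3 * m - t) - g (3 * m - (t + 1))| := by
      intro d _
      rw [Finset.range_eq_Ico]
      simpa using abs_sub_le_sum_range (fun t => g (3 * m - t)) (Nat.zero_le d)
    refine (Finset.sum_le_sum hr).trans (le_of_eq ?_)
    rw [sum_Icc_sum_range, Finset.sum_Ico_eq_sum_range, ← Finset.sum_range_reflect,
      show 3 * m - 2 * m = m by omega]
    refine Finset.sum_congr rfl fun t ht => ?_
    have ht := Finset.mem_range.1 ht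
    rw [show 3 * m - (m - 1 - t) = 2 * m + t + 1 by omega,
      show 3 * m - (m - 1 - t + 1) = 2 * m + t by omega, abs_sub_comm,
      show 1 + (m - 1 - (m - 1 - t)) = 1 + (2 * m + t - 2 * m) + (m - 1 - (2 * m + t)) by omega]
  rw [Finset.range_eq_Ico, ← Finset.sum_Ico_consecutive _ (Nat.zero_le m) (by omega : m ≤ 3 * m),
    ← Finset.sum_Ico_consecutive _ (by omega : m ≤ 2 * m) (by omega : 2 * m ≤ 3 * m)]
  linarith

/-- The lines at levels 1 to 2m have weight 1, those beyond have weight 0, and level 0 is handled by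
`side_ge`. -/
theorem dirVar_ge {m : ℕ} (hm : 0 < m) (f : ℕ → ℕ → ℕ → ℝ) :
    ∑ c ∈ Finset.Icc 1 (2 * m), lineVar m f c
      + (∑ d ∈ Finset.Icc 1 m, |f 0 0 (3 * m) - f 0 d (3 * m - d)|
      + ∑ d ∈ Finset.Icc 1 m, |f 0 (3 * m) 0 - f 0 (3 * m - d) d| + sideVar m f)
      ≤ dirVar m f := by
  have h0 := side_ge m (fun t => f 0 t (3 * m - t))
  have h1 : ∑ c ∈ Finset.Icc 1 (2 * m), lineVar m f c
      + ∑ t ∈ Finset.range (3 * m), lineWeight m 0 t *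
        |f 0 t (3 * m - 0 - t) - f 0 (t + 1) (3 * m - 0 - t - 1)| ≤ dirVar m f := by
    have hb := Finset.sum_range_add_sum_Ico (fun c => ∑ t ∈ Finset.range (3 * m - c),
      lineWeight m c t * |f c t (3 * m - c - t) - f c (t + 1) (3 * m - c - t - 1)|)
      (show 1 ≤ 3 * m by omega)
    rw [Finset.sum_range_one, Nat.sub_zero] at hb
    rw [dirVar, ← hb, Nat.sub_zero]
    refine (add_comm _ _).trans_le (add_le_add (le_refl _) ?_)
    refine le_trans ?_ (Finset.sum_le_sum_of_subset_of_nonneg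
      (s := Finset.Icc 1 (2 * m)) ?_ ?_)
    · refine Finset.sum_le_sum fun c hc => le_of_eq ?_
      have hc := Finset.mem_Icc.1 hc
      refine Finset.sum_congr rfl fun t _ => ?_
      rw [lineWeight, if_neg (by omega), if_pos hc.2, one_mul]
    · intro c hc
      have hc := Finset.mem_Icc.1 hc
      exact Finset.mem_Ico.2 (by omega)
    · exact fun c _ _ => Finset.sum_nonneg fun t _ =>
        mul_nonneg (lineWeight_nonneg _ _ _) (abs_nonneg _)
  refine le_trans (add_le_add le_rfl ?_) h1
  simp only [lineWeight, if_true, sideVar, Nat.sub_zero, Nat.sub_sub]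
  simp only [Nat.sub_zero, Nat.sub_self, show 3 * m - m = 2 * m by omega,
    show 3 * m - 2 * m = m by omega, Nat.sub_sub] at h0
  refine le_trans (le_of_eq ?_) h0
  congr 2
  refine Finset.sum_congr rfl fun d hd => ?_
  have hd := Finset.mem_Icc.1 hd
  rw [show 3 * m - (3 * m - d) = d by omega]

/-- Decomposition of the weights into paths. -/
theorem totalVar_ge {m : ℕ} (hm : 0 < m) (f : ℕ → ℕ → ℕ → ℝ) :
    ∑ d ∈ Finset.Icc 1 m, (pathVar m f d + pathVar m (rotate f) d + pathVar m (rotate (rotate f)) d)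
      + ∑ d ∈ Finset.Icc 1 m, (lineVar m f (m + d) + lineVar m (rotate f) (m + d)
        + lineVar m (rotate (rotate f)) (m + d))
      + (sideVar m f + sideVar m (rotate f) + sideVar m (rotate (rotate f))) ≤ totalVar m f := by
  have h1 := dirVar_ge hm f
  have h2 := dirVar_ge hm (rotate f)
  have h3 := dirVar_ge hm (rotate (rotate f))
  have hs : ∀ g : ℕ → ℝ, ∑ c ∈ Finset.Icc 1 (2 * m), g c
      = ∑ d ∈ Finset.Icc 1 m, g d + ∑ d ∈ Finset.Icc 1 m, g (m + d) := by
    intro g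
    have e : ∀ a b, Finset.Icc a b = Finset.Ico a (b + 1) := fun a b => by
      ext; simp
    rw [e, e, ← Finset.sum_Ico_consecutive _ (show 1 ≤ m + 1 by omega)
      (show m + 1 ≤ 2 * m + 1 by omega), Finset.sum_Ico_add]
    congr 2
    congr 1 <;> omega
  rw [hs] at h1 h2 h3
  -- The segments that prolong a line lie on sides belonging to the other two directions, so the
  -- terms match only across all three rotations.
  simp only [pathVar, Finset.sum_add_distrib, totalVar]
  simp only [rotate] at h1 h2 h3 ⊢
  linarith

/-! ### Boundary of a set at a corner -/

theorem lineVar_ge_ends (m : ℕ) (f : ℕ → ℕ → ℕ → ℝ) {c : ℕ} (h : c ≤ 3 * m) :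
    |f c 0 (3 * m - c) - f c (3 * m - c) 0| ≤ lineVar m f c := by
  have := lineVar_ge m f (show c + 0 + (3 * m - c) = 3 * m by omega)
  simpa using this

/-- The line x₁ = m+d ends on the side x₃ = 0 at the point where x₂ = m+(m-d) ends; the reindexing
pairs these lines. For d = m the partner would have level m, which is already used in a path, so d =
m stays fixed. -/
theorem sum_Icc_pair {m : ℕ} (hm : 0 < m) (g : ℕ → ℝ) :
    ∑ d ∈ Finset.Icc 1 m, g d = ∑ d ∈ Finset.Icc 1 m, g (if d = m then m else m - d) := by
  refine Finset.sum_nbij' (fun d => if d = m then m else m - d)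
    (fun d => if d = m then m else m - d) ?_ ?_ ?_ ?_ ?_
  all_goals
    intro d hd
    have hd := Finset.mem_Icc.1 hd
  · rw [Finset.mem_Icc]; split_ifs <;> omega
  · rw [Finset.mem_Icc]; split_ifs <;> omega
  · split_ifs <;> omega
  · split_ifs <;> omega
  · congr 1; split_ifs <;> omega

theorem sum_Icc_indicator_lt {m ν : ℕ} (hν : ν ≤ 2 * m) :
    ∑ d ∈ Finset.Icc 1 m, ((if ν < d then 1 else 0) + (if ν < m + d then 1 else 0) : ℝ)
      = 2 * m - ν := by
  have h1 : (Finset.Icc 1 m).filter (fun d => ν < d) = Finset.Ioc ν m := by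
    ext; simp only [Finset.mem_filter, Finset.mem_Icc, Finset.mem_Ioc]; omega
  have h2 : (Finset.Icc 1 m).filter (fun d => ν < m + d) = Finset.Ioc (ν - m) m := by
    ext; simp only [Finset.mem_filter, Finset.mem_Icc, Finset.mem_Ioc]; omega
  rw [Finset.sum_add_distrib, Finset.sum_boole, Finset.sum_boole, h1, h2, Nat.card_Ioc,
    Nat.card_Ioc]
  have : (m - ν) + (m - (ν - m)) + ν = 2 * m := by omega
  have h : ((m - ν : ℕ) : ℝ) + ((m - (ν - m) : ℕ) : ℝ) + ν = 2 * m := by exact_mod_cast this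
  linarith

/-- The boundary of a set that contains the corner `e¹`, avoids the opposite side and meets
every line `x₁ = c` with `ν < c ≤ 2m`. -/
theorem totalVar_ge_of_corner {m ν : ℕ} (hm : 0 < m) (hν : ν ≤ 2 * m) (f : ℕ → ℕ → ℕ → ℝ)
    (hcorner : f (3 * m) 0 0 = 1)
    (hopp : ∀ b c, b + c = 3 * m → f 0 b c = 0)
    (hlev : ∀ a, ν < a → a ≤ 2 * m → ∃ b c, a + b + c = 3 * m ∧ f a b c = 1) :
    2 * (3 * m - ν : ℝ) ≤ totalVar m f := by
  refine le_trans ?_ (totalVar_ge hm f)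
  -- A nonzero value at an end of the line is a loss. It is repaid by `hrot` and `hrot2`: the line
  -- of another direction through that end runs to the side x₁ = 0, where `f` vanishes.
  have hline : ∀ a, ν < a → a ≤ 2 * m →
      (1 - f a 0 (3 * m - a)) + (1 - f a (3 * m - a) 0) ≤ lineVar m f a := by
    intro a h1 h2
    obtain ⟨b, c, hs, h⟩ := hlev a h1 h2
    have h3 := lineVar_ge m f hs
    rw [h] at h3
    have h4 := neg_abs_le (f a 0 (3 * m - a) - 1)
    have h5 := le_abs_self (1 - f a (3 * m - a) 0)
    linarith
  have hrot : ∀ a, a ≤ 3 * m → f (3 * m - a) a 0 ≤ lineVar m (rotate f) a := by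
    intro a ha
    have h := lineVar_ge_ends m (rotate f) ha
    simp only [rotate] at h
    rw [hopp a (3 * m - a) (by omega), sub_zero] at h
    exact (le_abs_self _).trans h
  have hrot2 : ∀ a, a ≤ 3 * m → f (3 * m - a) 0 a ≤ lineVar m (rotate (rotate f)) a := by
    intro a ha
    have h := lineVar_ge_ends m (rotate (rotate f)) ha
    simp only [rotate] at h
    rw [hopp (3 * m - a) a (by omega), zero_sub, abs_neg] at h
    exact (le_abs_self _).trans h
  -- The paths of the two other directions join e¹ to another corner and give 1 each. The path of
  -- the first direction joins two corners with value 0 and, for d > ν, passes through a point with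
  -- value 1.
  have hpath : ∀ d ∈ Finset.Icc 1 m, 2 + 2 * (if ν < d then (1 : ℝ) else 0) ≤
      pathVar m f d + pathVar m (rotate f) d + pathVar m (rotate (rotate f)) d := by
    intro d hd
    have hd := Finset.mem_Icc.1 hd
    have h1 := hrot d (by omega)
    have h2 := hrot2 d (by omega)
    have h3 := le_abs_self (f (3 * m) 0 0 - f (3 * m - d) d 0)
    have h4 := le_abs_self (f (3 * m) 0 0 - f (3 * m - d) 0 d)
    have h5 : 2 * (if ν < d then (1 : ℝ) else 0) ≤ pathVar m f d := by
      simp only [pathVar]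
      rw [hopp _ _ (show 3 * m + 0 = 3 * m by omega), hopp _ _ (show 0 + 3 * m = 3 * m by omega)]
      have h7 := neg_abs_le (0 - f d (3 * m - d) 0)
      have h8 := neg_abs_le (0 - f d 0 (3 * m - d))
      split_ifs with h
      · have h6 := hline d h (by omega)
        linarith
      · have h6 := lineVar_nonneg m f d
        have := abs_nonneg (0 - f d (3 * m - d) 0)
        have := abs_nonneg (0 - f d 0 (3 * m - d))
        linarith
    have h6 : 1 ≤ pathVar m (rotate f) d := by
      simp only [pathVar]
      have := abs_nonneg (rotate f 0 (3 * m) 0 - rotate f d (3 * m - d) 0)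
      simp only [rotate] at this ⊢
      linarith
    have h7 : 1 ≤ pathVar m (rotate (rotate f)) d := by
      simp only [pathVar]
      have := abs_nonneg (rotate (rotate f) 0 0 (3 * m) - rotate (rotate f) d 0 (3 * m - d))
      simp only [rotate] at this ⊢
      linarith
    linarith
  have hmid : ∑ d ∈ Finset.Icc 1 m, 2 * (if ν < m + d then (1 : ℝ) else 0) ≤
      ∑ d ∈ Finset.Icc 1 m, (lineVar m f (m + d) + lineVar m (rotate f) (m + d)
        + lineVar m (rotate (rotate f)) (m + d))
      + (sideVar m f + sideVar m (rotate f) + sideVar m (rotate (rotate f))) := by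
    obtain ⟨k, rfl⟩ : ∃ k, m = k + 1 := ⟨m - 1, by omega⟩
    have e := sum_Icc_pair hm (fun d => lineVar (k + 1) (rotate f) (k + 1 + d)
        + lineVar (k + 1) (rotate (rotate f)) (k + 1 + d))
    simp only [add_assoc, Finset.sum_add_distrib] at e ⊢
    simp only [← add_assoc] at e ⊢
    have hs : ∑ d ∈ Finset.Icc 1 (k + 1), 2 * (if ν < k + 1 + d then (1 : ℝ) else 0) ≤
        ∑ d ∈ Finset.Icc 1 (k + 1), (lineVar (k + 1) f (k + 1 + d)
          + lineVar (k + 1) (rotate f) (k + 1 + if d = k + 1 then k + 1 else k + 1 - d)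
          + lineVar (k + 1) (rotate (rotate f)) (k + 1 + if d = k + 1 then k + 1 else k + 1 - d))
        + (sideVar (k + 1) (rotate f) + sideVar (k + 1) (rotate (rotate f))) := by
      rw [Finset.sum_Icc_succ_top (by omega), Finset.sum_Icc_succ_top (by omega)]
      refine (add_le_add (Finset.sum_le_sum fun d hd => ?_) ?_).trans (add_assoc _ _ _).ge
      · have hd := Finset.mem_Icc.1 hd
        rw [if_neg (show d ≠ k + 1 by omega)]
        have h1 := hrot (k + 1 + (k + 1 - d)) (by omega)
        have h2 := hrot2 (k + 1 + (k + 1 - d)) (by omega)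
        rw [show 3 * (k + 1) - (k + 1 + (k + 1 - d)) = k + 1 + d by omega] at h1 h2
        split_ifs with h
        · have h3 := hline (k + 1 + d) h (by omega)
          rw [show 3 * (k + 1) - (k + 1 + d) = k + 1 + (k + 1 - d) by omega] at h3
          linarith
        · have h3 := lineVar_nonneg (k + 1) f (k + 1 + d)
          have h4 := lineVar_nonneg (k + 1) (rotate f) (k + 1 + (k + 1 - d))
          have h5 := lineVar_nonneg (k + 1) (rotate (rotate f)) (k + 1 + (k + 1 - d))
          linarith
      -- The case d = m. The middle third of the side x₃ = 0 leads from the end (2m, m, 0) of the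
      -- line x₁ = 2m to (m, 2m, 0), where the line x₂ = 2m starts; similarly on x₂ = 0. This is the
      -- only use of the middle thirds.
      · rw [if_pos rfl]
        have h1 := hrot (k + 1 + (k + 1)) (by omega)
        have h2 := hrot2 (k + 1 + (k + 1)) (by omega)
        rw [show 3 * (k + 1) - (k + 1 + (k + 1)) = k + 1 by omega] at h1 h2
        have s1 : f (2 * (k + 1)) 0 (k + 1) - f (k + 1) 0 (2 * (k + 1)) ≤
          sideVar (k + 1) (rotate f) := le_abs_self _
        have s2 : f (2 * (k + 1)) (k + 1) 0 - f (k + 1) (2 * (k + 1)) 0 ≤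
            sideVar (k + 1) (rotate (rotate f)) := by
          rw [sideVar, abs_sub_comm]
          exact le_abs_self _
        have s3 : 0 ≤ sideVar (k + 1) (rotate f) := abs_nonneg _
        have s4 : 0 ≤ sideVar (k + 1) (rotate (rotate f)) := abs_nonneg _
        have h4 := lineVar_nonneg (k + 1) (rotate f) (k + 1 + (k + 1))
        have h5 := lineVar_nonneg (k + 1) (rotate (rotate f)) (k + 1 + (k + 1))
        split_ifs with h
        · have h3 := hline (k + 1 + (k + 1)) h (by omega)
          rw [show 3 * (k + 1) - (k + 1 + (k + 1)) = k + 1 by omega] at h3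
          rw [← two_mul] at h1 h2 h3 ⊢
          linarith
        · have h3 := lineVar_nonneg (k + 1) f (k + 1 + (k + 1))
          linarith
    have s0 : 0 ≤ sideVar (k + 1) f := abs_nonneg _
    simp only [Finset.sum_add_distrib] at hs
    linarith
  have hsum := Finset.sum_le_sum hpath
  have hcount := sum_Icc_indicator_lt hν
  simp only [Finset.sum_add_distrib, ← Finset.mul_sum, Finset.sum_const, Nat.card_Icc] at *
  simp only [Nat.add_sub_cancel, nsmul_eq_mul] at *
  linarith

/-! ### Boundary of a set away from the corners -/

theorem pathVar_ge_two {m : ℕ} {g : ℕ → ℕ → ℕ → ℝ} (h2 : g 0 (3 * m) 0 = 0)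
    (h3 : g 0 0 (3 * m) = 0) {d t u : ℕ} (hs : d + t + u = 3 * m) (h : g d t u = 1) :
    2 ≤ pathVar m g d := by
  have h4 := lineVar_ge m g hs
  rw [h] at h4
  rw [pathVar, h2, h3]
  have := neg_abs_le (g d 0 (3 * m - d) - 1)
  have := le_abs_self (1 - g d (3 * m - d) 0)
  have := neg_abs_le (0 - g d 0 (3 * m - d))
  have := neg_abs_le (0 - g d (3 * m - d) 0)
  linarith

theorem pathVar_nonneg (m : ℕ) (f : ℕ → ℕ → ℕ → ℝ) (d : ℕ) : 0 ≤ pathVar m f d :=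
  add_nonneg (add_nonneg (lineVar_nonneg m f d) (abs_nonneg _)) (abs_nonneg _)

theorem lineVar_ge_one {m : ℕ} {g : ℕ → ℕ → ℕ → ℝ} (h01 : ∀ a b c, g a b c = 0 ∨ g a b c = 1)
    {c t u t' u' : ℕ} (hs : c + t + u = 3 * m) (h : g c t u = 1)
    (hs' : c + t' + u' = 3 * m) (h' : g c t' u' = 0) : 1 ≤ lineVar m g c := by
  have h1 := lineVar_ge m g hs
  have h2 := lineVar_ge m g hs'
  rw [h] at h1
  rw [h'] at h2
  rcases h01 c 0 (3 * m - c) with e | e <;> rcases h01 c (3 * m - c) 0 with e' | e' <;>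
    rw [e, e'] at h1 h2 <;> norm_num at h1 h2 <;> linarith

/-- `g` equals one on the truncated triangle `x₁ ≤ p`, `x₂ ≤ q`, `x₃ ≤ r`. -/
def OneOn (m : ℕ) (g : ℕ → ℕ → ℕ → ℝ) (p q r : ℕ) : Prop :=
  ∀ a b c, a + b + c = 3 * m → a ≤ p → b ≤ q → c ≤ r → g a b c = 1

theorem OneOn.rotate {m : ℕ} {g : ℕ → ℕ → ℕ → ℝ} {p q r : ℕ} (h : OneOn m g p q r) :
    OneOn m (rotate g) q r p :=
  fun a b c hs ha hb hc => h c a b (by omega) hc ha hb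

theorem OneOn.exists_of_line {m : ℕ} {g : ℕ → ℕ → ℕ → ℝ} {p q r c : ℕ} (h : OneOn m g p q r)
    (h1 : c ≤ p) (h2 : 3 * m ≤ c + q + r) (h3 : c ≤ 3 * m) :
    ∃ t u, c + t + u = 3 * m ∧ g c t u = 1 := by
  have hs : c + min q (3 * m - c) + (3 * m - c - min q (3 * m - c)) = 3 * m := by omega
  exact ⟨_, _, hs, h _ _ _ hs h1 (by omega) (by omega)⟩

/-- The truncated triangle meets the levels from max(0, 3m-q-r) to p, and level 0 is not counted. If
3m-q-r ≥ 1, there are p+q+r-3m+1 such levels, each of weight at least 1. Otherwise they are 1, …, p,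
with weight 2 up to m and 1 above. -/
theorem card_lines_ge {m p q r : ℕ} (hp : p ≤ 2 * m) (hs : 3 * m < p + q + r) :
    ((min (p + q + r - 3 * m + 1) (p + min p m) : ℕ) : ℝ) ≤
      ∑ d ∈ Finset.Icc 1 m, 2 * (if d ≤ p ∧ 3 * m ≤ d + q + r then 1 else 0 : ℝ)
      + ∑ d ∈ Finset.Icc 1 m, (if m + d ≤ p ∧ 3 * m ≤ m + d + q + r then 1 else 0 : ℝ) := by
  have h1 : (Finset.Icc 1 m).filter (fun d => d ≤ p ∧ 3 * m ≤ d + q + r)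
      = Finset.Icc (max 1 (3 * m - q - r)) (min m p) := by
    ext; simp only [Finset.mem_filter, Finset.mem_Icc]; omega
  have h2 : (Finset.Icc 1 m).filter (fun d => m + d ≤ p ∧ 3 * m ≤ m + d + q + r)
      = Finset.Icc (max 1 (3 * m - q - r - m)) (p - m) := by
    ext; simp only [Finset.mem_filter, Finset.mem_Icc]; omega
  rw [← Finset.mul_sum, Finset.sum_boole, Finset.sum_boole, h1, h2, Nat.card_Icc, Nat.card_Icc]
  have : min (p + q + r - 3 * m + 1) (p + min p m) ≤
      2 * (min m p + 1 - max 1 (3 * m - q - r)) + (p - m + 1 - max 1 (3 * m - q - r - m)) := by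
    omega
  exact_mod_cast this

/-- The lines of one direction, when no line of this direction in the middle lies in the set. -/
theorem dir_ge_of_oneOn {m p q r : ℕ} {g : ℕ → ℕ → ℕ → ℝ}
    (h01 : ∀ a b c, g a b c = 0 ∨ g a b c = 1)
    (e2 : g 0 (3 * m) 0 = 0) (e3 : g 0 0 (3 * m) = 0) (hT : OneOn m g p q r)
    (hp : p ≤ 2 * m) (hs : 3 * m < p + q + r)
    (hmid : ∀ c, m < c → c ≤ 2 * m → ∃ t u, c + t + u = 3 * m ∧ g c t u = 0) :
    ((min (p + q + r - 3 * m + 1) (p + min p m) : ℕ) : ℝ) ≤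
      ∑ d ∈ Finset.Icc 1 m, pathVar m g d + ∑ d ∈ Finset.Icc 1 m, lineVar m g (m + d) := by
  refine (card_lines_ge hp hs).trans (add_le_add ?_ ?_) <;>
    refine Finset.sum_le_sum fun d hd => ?_
  all_goals have hd := Finset.mem_Icc.1 hd
  · split_ifs with h
    · obtain ⟨t, u, hs, h⟩ := hT.exists_of_line h.1 h.2 (by omega)
      rw [mul_one]
      exact pathVar_ge_two e2 e3 hs h
    · simpa using pathVar_nonneg m g d
  · split_ifs with h
    · obtain ⟨t, u, hs, h⟩ := hT.exists_of_line h.1 h.2 (by omega)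
      obtain ⟨t', u', hs', h'⟩ := hmid (m + d) (by omega) (by omega)
      exact lineVar_ge_one h01 hs h hs' h'
    · exact lineVar_nonneg m g _

theorem sideVar_nonneg (m : ℕ) (f : ℕ → ℕ → ℕ → ℝ) : 0 ≤ sideVar m f := abs_nonneg _

/-- The case of a middle line that lies in the set. -/
theorem totalVar_ge_of_line {m p q r : ℕ} (hm : 0 < m) {g : ℕ → ℕ → ℕ → ℝ}
    (e1 : g (3 * m) 0 0 = 0) (e2 : g 0 (3 * m) 0 = 0) (e3 : g 0 0 (3 * m) = 0)
    (hT : OneOn m g p q r) (hp : p ≤ 2 * m) (hq : q ≤ 2 * m) (hr : r ≤ 2 * m)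
    {c : ℕ} (hc : c ≤ 2 * m) (hl : ∀ t u, c + t + u = 3 * m → g c t u = 1) :
    2 * (p + q + r - 3 * m : ℝ) ≤ totalVar m g := by
  refine le_trans ?_ (totalVar_ge hm g)
  have h0 : 0 ≤ ∑ d ∈ Finset.Icc 1 m, (lineVar m g (m + d) + lineVar m (rotate g) (m + d)
        + lineVar m (rotate (rotate g)) (m + d)) :=
    Finset.sum_nonneg fun d _ => add_nonneg (add_nonneg (lineVar_nonneg _ _ _)
      (lineVar_nonneg _ _ _)) (lineVar_nonneg _ _ _)
  have hs1 := sideVar_nonneg m g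
  have hs2 := sideVar_nonneg m (rotate g)
  have hs3 := sideVar_nonneg m (rotate (rotate g))
  -- Since c + d ≤ 3m, every path of another direction crosses the line x₁ = c.
  have h1 : ∑ d ∈ Finset.Icc 1 m, 2 ≤ ∑ d ∈ Finset.Icc 1 m, pathVar m (rotate g) d := by
    refine Finset.sum_le_sum fun d hd => ?_
    have hd := Finset.mem_Icc.1 hd
    exact pathVar_ge_two (g := rotate g) e3 e1 (t := 3 * m - c - d) (u := c) (by omega)
      (hl _ _ (by omega))
  have h2 : ∑ d ∈ Finset.Icc 1 m, 2 ≤ ∑ d ∈ Finset.Icc 1 m, pathVar m (rotate (rotate g)) d := by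
    refine Finset.sum_le_sum fun d hd => ?_
    have hd := Finset.mem_Icc.1 hd
    exact pathVar_ge_two (g := rotate (rotate g)) e1 e2 (t := c) (u := 3 * m - c - d) (by omega)
      (hl _ _ (by omega))
  have h3 : 0 ≤ ∑ d ∈ Finset.Icc 1 m, pathVar m g d :=
    Finset.sum_nonneg fun d _ => pathVar_nonneg m g d
  simp only [Finset.sum_const, Nat.card_Icc, Nat.add_sub_cancel, nsmul_eq_mul] at h1 h2
  rw [Finset.sum_add_distrib, Finset.sum_add_distrib]
  -- The two other directions give 4m, which suffices up to p+q+r = 5m. Beyond that, p > m and q+r >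
  -- 3m, so the paths x₁ = d meet the truncated triangle as well; the resulting 6m suffices as p+q+r
  -- ≤ 6m.
  by_cases hs : p + q + r ≤ 5 * m
  · have : (p + q + r : ℝ) ≤ 5 * m := by exact_mod_cast hs
    linarith
  · have h4 : ∑ d ∈ Finset.Icc 1 m, 2 ≤ ∑ d ∈ Finset.Icc 1 m, pathVar m g d := by
      refine Finset.sum_le_sum fun d hd => ?_
      have hd := Finset.mem_Icc.1 hd
      obtain ⟨t, u, hs, h⟩ := hT.exists_of_line (c := d) (by omega) (by omega) (by omega)
      exact pathVar_ge_two e2 e3 hs h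
    simp only [Finset.sum_const, Nat.card_Icc, Nat.add_sub_cancel, nsmul_eq_mul] at h4
    have : (p + q + r : ℝ) ≤ 6 * m := by exact_mod_cast (by omega : p + q + r ≤ 6 * m)
    linarith

/-- The boundary of a set that avoids the corners and contains a truncated triangle. -/
theorem totalVar_ge_of_oneOn {m p q r : ℕ} (hm : 0 < m) {g : ℕ → ℕ → ℕ → ℝ}
    (h01 : ∀ a b c, g a b c = 0 ∨ g a b c = 1)
    (e1 : g (3 * m) 0 0 = 0) (e2 : g 0 (3 * m) 0 = 0) (e3 : g 0 0 (3 * m) = 0)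
    (hT : OneOn m g p q r) (hp : p ≤ 2 * m) (hq : q ≤ 2 * m) (hr : r ≤ 2 * m)
    (hs : 3 * m < p + q + r) :
    2 * (p + q + r - 3 * m : ℝ) ≤ totalVar m g := by
  -- If no middle line lies wholly in the set, each one that meets the truncated triangle contains
  -- both values and costs one unit.
  have hnot : ∀ f : ℕ → ℕ → ℕ → ℝ, (∀ a b c, f a b c = 0 ∨ f a b c = 1) →
      (∃ c, m < c ∧ c ≤ 2 * m ∧ ∀ t u, c + t + u = 3 * m → f c t u = 1) ∨
      ∀ c, m < c → c ≤ 2 * m → ∃ t u, c + t + u = 3 * m ∧ f c t u = 0 := by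
    intro f hf
    by_contra! h
    obtain ⟨h1, c, hc, hc', h2⟩ := h
    obtain ⟨t, u, hs, h3⟩ := h1 c hc hc'
    exact h2 t u hs ((hf c t u).resolve_right h3)
  rcases hnot g h01 with ⟨c, _, hc, hl⟩ | n1
  · exact totalVar_ge_of_line hm e1 e2 e3 hT hp hq hr hc hl
  rcases hnot (rotate g) (fun a b c => h01 c a b) with ⟨c, _, hc, hl⟩ | n2
  · rw [← totalVar_rotate]
    have := totalVar_ge_of_line (g := rotate g) hm e2 e3 e1 hT.rotate hq hr hp hc hl
    linarith
  rcases hnot (rotate (rotate g)) (fun a b c => h01 b c a) with ⟨c, _, hc, hl⟩ | n3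
  · rw [← totalVar_rotate, ← totalVar_rotate]
    have := totalVar_ge_of_line (g := rotate (rotate g)) hm e3 e1 e2 hT.rotate.rotate hr hp hq
      hc hl
    linarith
  refine le_trans ?_ (totalVar_ge hm g)
  have h1 := dir_ge_of_oneOn h01 e2 e3 hT hp hs n1
  have h2 := dir_ge_of_oneOn (g := rotate g) (fun a b c => h01 c a b) e3 e1 hT.rotate hq
    (by omega) n2
  have h3 := dir_ge_of_oneOn (g := rotate (rotate g)) (fun a b c => h01 b c a) e1 e2
    hT.rotate.rotate hr (by omega) n3
  have hs1 := sideVar_nonneg m g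
  have hs2 := sideVar_nonneg m (rotate g)
  have hs3 := sideVar_nonneg m (rotate (rotate g))
  have h4 : 2 * (p + q + r) ≤ 2 * (3 * m) + (min (p + q + r - 3 * m + 1) (p + min p m)
      + min (q + r + p - 3 * m + 1) (q + min q m) + min (r + p + q - 3 * m + 1) (r + min r m)) := by
    omega
  have h5 : 2 * (p + q + r : ℝ) ≤ 2 * (3 * m)
      + (((min (p + q + r - 3 * m + 1) (p + min p m) : ℕ) : ℝ)
      + ((min (q + r + p - 3 * m + 1) (q + min q m) : ℕ) : ℝ)
      + ((min (r + p + q - 3 * m + 1) (r + min r m) : ℕ) : ℝ)) := by exact_mod_cast h4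
  simp only [Finset.sum_add_distrib]
  linarith

/-! ### Non-opposite cuts of the triangle -/

/-- The weighted sum of `D` over the edges of the triangular grid of size `3m`. -/
noncomputable def edgeSum (m : ℕ) (D : ℕ → ℕ → ℕ → ℕ → ℕ → ℕ → ℝ) : ℝ :=
  ∑ c ∈ Finset.range (3 * m), ∑ t ∈ Finset.range (3 * m - c), lineWeight m c t *
    (D c t (3 * m - c - t) c (t + 1) (3 * m - c - t - 1)
      + D (3 * m - c - t) c t (3 * m - c - t - 1) c (t + 1)
      + D t (3 * m - c - t) c (t + 1) (3 * m - c - t - 1) c)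

theorem edgeSum_abs (m : ℕ) (f : ℕ → ℕ → ℕ → ℝ) :
    edgeSum m (fun a b c a' b' c' => |f a b c - f a' b' c'|) = totalVar m f := by
  simp only [edgeSum, totalVar, dirVar, mul_add, Finset.sum_add_distrib, rotate]

/-- The comparison is needed for neighbours only; their small coordinate steps keep a label from
jumping over a free level. -/
theorem edgeSum_le_edgeSum {m : ℕ} {D D' : ℕ → ℕ → ℕ → ℕ → ℕ → ℕ → ℝ}
    (h : ∀ a b c a' b' c', a + b + c = 3 * m → a' + b' + c' = 3 * m →
      a ≤ a' + 1 → a' ≤ a + 1 → b ≤ b' + 1 → b' ≤ b + 1 → c ≤ c' + 1 → c' ≤ c + 1 →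
      D a b c a' b' c' ≤ D' a b c a' b' c') : edgeSum m D ≤ edgeSum m D' := by
  refine Finset.sum_le_sum fun c hc => Finset.sum_le_sum fun t ht => ?_
  have hc := Finset.mem_range.1 hc
  have ht := Finset.mem_range.1 ht
  refine mul_le_mul_of_nonneg_left ?_ (lineWeight_nonneg m c t)
  refine add_le_add (add_le_add ?_ ?_) ?_ <;> apply h <;> omega

theorem edgeSum_const_mul (m : ℕ) (r : ℝ) (D : ℕ → ℕ → ℕ → ℕ → ℕ → ℕ → ℝ) :
    edgeSum m (fun a b c a' b' c' => r * D a b c a' b' c') = r * edgeSum m D := by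
  simp only [edgeSum, Finset.mul_sum]
  exact Finset.sum_congr rfl fun _ _ => Finset.sum_congr rfl fun _ _ => by ring

theorem edgeSum_add (m : ℕ) (D D' : ℕ → ℕ → ℕ → ℕ → ℕ → ℕ → ℝ) :
    edgeSum m (fun a b c a' b' c' => D a b c a' b' c' + D' a b c a' b' c')
      = edgeSum m D + edgeSum m D' := by
  simp only [edgeSum, ← Finset.sum_add_distrib]
  exact Finset.sum_congr rfl fun _ _ => Finset.sum_congr rfl fun _ _ => by ring

/-- Freeness of ν lets a label be truncated there without new boundary. Maximality makes the
truncated set meet every line above, as `totalVar_ge_of_corner` requires. -/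
theorem exists_free_level (Q : ℕ → Prop) (h0 : ¬ Q 0) (N : ℕ) :
    ∃ ν ≤ N, ¬ Q ν ∧ ∀ c, ν < c → c ≤ N → Q c := by
  classical
  refine ⟨Nat.findGreatest (fun c => ¬ Q c) N, Nat.findGreatest_le N,
    Nat.findGreatest_spec (P := fun c => ¬ Q c) (Nat.zero_le N) h0, fun c h1 h2 => ?_⟩
  exact not_not.1 (Nat.findGreatest_is_greatest h1 h2)

/-- An edge leaves at most one and enters at most one of four sets that partition the points. -/
theorem abs_oneHot_le_two {x1 x2 x3 y1 y2 y3 : ℝ}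
    (hx : (x1 = 1 ∧ x2 = 0 ∧ x3 = 0) ∨ (x1 = 0 ∧ x2 = 1 ∧ x3 = 0) ∨ (x1 = 0 ∧ x2 = 0 ∧ x3 = 1)
      ∨ (x1 = 0 ∧ x2 = 0 ∧ x3 = 0))
    (hy : (y1 = 1 ∧ y2 = 0 ∧ y3 = 0) ∨ (y1 = 0 ∧ y2 = 1 ∧ y3 = 0) ∨ (y1 = 0 ∧ y2 = 0 ∧ y3 = 1)
      ∨ (y1 = 0 ∧ y2 = 0 ∧ y3 = 0)) :
    |x1 - y1| + |x2 - y2| + |x3 - y3| + |(1 - x1 - x2 - x3) - (1 - y1 - y2 - y3)| ≤ 2 := by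
  rcases hx with ⟨rfl, rfl, rfl⟩ | ⟨rfl, rfl, rfl⟩ | ⟨rfl, rfl, rfl⟩ | ⟨rfl, rfl, rfl⟩ <;>
    rcases hy with ⟨rfl, rfl, rfl⟩ | ⟨rfl, rfl, rfl⟩ | ⟨rfl, rfl, rfl⟩ | ⟨rfl, rfl, rfl⟩ <;>
    norm_num

open scoped Classical in
/-- Every non-opposite cut of the triangle costs at least `6m` units. -/
theorem edgeSum_ne_ge {α : Type*} {m : ℕ} (hm : 0 < m) (F : ℕ → ℕ → ℕ → α) {l₁ l₂ l₃ : α}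
    (h12 : l₁ ≠ l₂) (h13 : l₁ ≠ l₃) (h23 : l₂ ≠ l₃)
    (c1 : F (3 * m) 0 0 = l₁) (c2 : F 0 (3 * m) 0 = l₂) (c3 : F 0 0 (3 * m) = l₃)
    (o1 : ∀ b c, b + c = 3 * m → F 0 b c ≠ l₁) (o2 : ∀ a c, a + c = 3 * m → F a 0 c ≠ l₂)
    (o3 : ∀ a b, a + b = 3 * m → F a b 0 ≠ l₃) :
    6 * m ≤ edgeSum m (fun a b c a' b' c' => if F a b c = F a' b' c' then 0 else 1) := by
  obtain ⟨p, hp, np, lp⟩ := exists_free_level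
    (fun a => ∃ b c, a + b + c = 3 * m ∧ F a b c = l₁)
    (fun ⟨b, c, h, h'⟩ => o1 b c (by omega) h') (2 * m)
  obtain ⟨q, hq, nq, lq⟩ := exists_free_level
    (fun b => ∃ c a, b + c + a = 3 * m ∧ F a b c = l₂)
    (fun ⟨c, a, h, h'⟩ => o2 a c (by omega) h') (2 * m)
  obtain ⟨r, hr, nr, lr⟩ := exists_free_level
    (fun c => ∃ a b, c + a + b = 3 * m ∧ F a b c = l₃)
    (fun ⟨a, b, h, h'⟩ => o3 a b (by omega) h') (2 * m)
  push Not at np nq nr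
  let f₁ : ℕ → ℕ → ℕ → ℝ := fun a b c => if F a b c = l₁ ∧ p < a then 1 else 0
  let f₂ : ℕ → ℕ → ℕ → ℝ := fun a b c => if F a b c = l₂ ∧ q < b then 1 else 0
  let f₃ : ℕ → ℕ → ℕ → ℝ := fun a b c => if F a b c = l₃ ∧ r < c then 1 else 0
  let g : ℕ → ℕ → ℕ → ℝ := fun a b c => 1 - f₁ a b c - f₂ a b c - f₃ a b c
  have hot : ∀ a b c, (f₁ a b c = 1 ∧ f₂ a b c = 0 ∧ f₃ a b c = 0) ∨
      (f₁ a b c = 0 ∧ f₂ a b c = 1 ∧ f₃ a b c = 0) ∨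
      (f₁ a b c = 0 ∧ f₂ a b c = 0 ∧ f₃ a b c = 1) ∨
      (f₁ a b c = 0 ∧ f₂ a b c = 0 ∧ f₃ a b c = 0) := by
    intro a b c
    simp only [f₁, f₂, f₃]
    by_cases h1 : F a b c = l₁
    · have h2 : F a b c ≠ l₂ := h1 ▸ h12
      have h3 : F a b c ≠ l₃ := h1 ▸ h13
      by_cases h : p < a <;> simp [h1, h12, h13, h]
    · by_cases h2 : F a b c = l₂
      · by_cases h : q < b <;> simp [h2, h12.symm, h23, h]
      · by_cases h3 : F a b c = l₃
        · by_cases h : r < c <;> simp [h3, h13.symm, h23.symm, h]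
        · simp [h1, h2, h3]
  have cost : totalVar m f₁ + totalVar m f₂ + totalVar m f₃ + totalVar m g ≤
      2 * edgeSum m (fun a b c a' b' c' => if F a b c = F a' b' c' then 0 else 1) := by
    simp only [← edgeSum_abs, ← edgeSum_add, ← edgeSum_const_mul]
    refine edgeSum_le_edgeSum fun a b c a' b' c' hs hs' ha ha' hb hb' hc hc' => ?_
    split_ifs with h
    -- Two neighbours labelled `l₁` lie on the same side of level p: their first coordinates differ
    -- by at most 1, and neither equals p.
    · have e1 : f₁ a b c = f₁ a' b' c' := by
        simp only [f₁, ← h]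
        by_cases hl : F a b c = l₁
        · have n1 : a ≠ p := fun e => np b c (by omega) (e ▸ hl)
          have n2 : a' ≠ p := fun e => np b' c' (by omega) (e ▸ h ▸ hl)
          have : p < a ↔ p < a' := by omega
          simp only [this]
        · simp only [hl, false_and]
      have e2 : f₂ a b c = f₂ a' b' c' := by
        simp only [f₂, ← h]
        by_cases hl : F a b c = l₂
        · have n1 : b ≠ q := fun e => nq c a (by omega) (e ▸ hl)
          have n2 : b' ≠ q := fun e => nq c' a' (by omega) (e ▸ h ▸ hl)
          have : q < b ↔ q < b' := by omega
          simp only [this]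
        · simp only [hl, false_and]
      have e3 : f₃ a b c = f₃ a' b' c' := by
        simp only [f₃, ← h]
        by_cases hl : F a b c = l₃
        · have n1 : c ≠ r := fun e => nr a b (by omega) (e ▸ hl)
          have n2 : c' ≠ r := fun e => nr a' b' (by omega) (e ▸ h ▸ hl)
          have : r < c ↔ r < c' := by omega
          simp only [this]
        · simp only [hl, false_and]
      simp [g, e1, e2, e3]
    · exact (abs_oneHot_le_two (hot a b c) (hot a' b' c')).trans (by norm_num)
  have b1 : 2 * (3 * m - p : ℝ) ≤ totalVar m f₁ := by
    refine totalVar_ge_of_corner hm hp f₁ ?_ ?_ ?_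
    · exact if_pos ⟨c1, by omega⟩
    · exact fun b c _ => if_neg (by omega)
    · intro a h1 h2
      obtain ⟨b, c, hs, h⟩ := lp a h1 h2
      exact ⟨b, c, hs, if_pos ⟨h, h1⟩⟩
  have b2 : 2 * (3 * m - q : ℝ) ≤ totalVar m f₂ := by
    rw [← totalVar_rotate]
    refine totalVar_ge_of_corner hm hq (rotate f₂) ?_ ?_ ?_
    · exact if_pos ⟨c2, by omega⟩
    · exact fun b c _ => if_neg (by omega)
    · intro a h1 h2
      obtain ⟨b, c, hs, h⟩ := lq a h1 h2
      exact ⟨b, c, hs, if_pos ⟨h, h1⟩⟩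
  have b3 : 2 * (3 * m - r : ℝ) ≤ totalVar m f₃ := by
    rw [← totalVar_rotate, ← totalVar_rotate]
    refine totalVar_ge_of_corner hm hr (rotate (rotate f₃)) ?_ ?_ ?_
    · exact if_pos ⟨c3, by omega⟩
    · exact fun b c _ => if_neg (by omega)
    · intro a h1 h2
      obtain ⟨b, c, hs, h⟩ := lr a h1 h2
      exact ⟨b, c, hs, if_pos ⟨h, h1⟩⟩
  -- The corner sets give 2(9m-p-q-r). This is at least 12m if p+q+r ≤ 3m; otherwise `g` supplies
  -- the missing 2(p+q+r-3m).
  by_cases hs : 3 * m < p + q + r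
  · have b4 : 2 * (p + q + r - 3 * m : ℝ) ≤ totalVar m g := by
      refine totalVar_ge_of_oneOn hm ?_ ?_ ?_ ?_ ?_ hp hq hr hs
      · intro a b c
        simp only [g]
        rcases hot a b c with ⟨h1, h2, h3⟩ | ⟨h1, h2, h3⟩ | ⟨h1, h2, h3⟩ | ⟨h1, h2, h3⟩ <;>
          rw [h1, h2, h3] <;> norm_num
      · simp [g, f₁, f₂, f₃, c1, h12, h13, show p < 3 * m by omega]
      · simp [g, f₁, f₂, f₃, c2, h12.symm, h23, show q < 3 * m by omega]
      · simp [g, f₁, f₂, f₃, c3, h13.symm, h23.symm, show r < 3 * m by omega]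
      · intro a b c _ ha hb hc
        simp [g, f₁, f₂, f₃, ha.not_gt, hb.not_gt, hc.not_gt]
    linarith
  · have b4 : 0 ≤ totalVar m g := by
      rw [← edgeSum_abs]
      refine Finset.sum_nonneg fun c _ => Finset.sum_nonneg fun t _ =>
        mul_nonneg (lineWeight_nonneg m c t) (by positivity)
    have : (p + q + r : ℝ) ≤ 3 * m := by exact_mod_cast not_lt.1 hs
    linarith

/-! ### Total weight of the triangle -/

theorem sum_range_cast (m : ℕ) : ∑ t ∈ Finset.range m, (t : ℝ) = m * (m - 1) / 2 := by
  induction m with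
  | zero => simp
  | succ m ih => rw [Finset.sum_range_succ, ih]; push_cast; ring

theorem sum_lineWeight_zero (m : ℕ) :
    ∑ t ∈ Finset.range (3 * m), lineWeight m 0 t = (m : ℝ) ^ 2 + 2 * m := by
  have h1 : ∑ t ∈ Finset.range (2 * m + m), ((t - 2 * m : ℕ) : ℝ) = m * (m - 1) / 2 := by
    rw [Finset.sum_range_add, ← sum_range_cast, Finset.sum_eq_zero, zero_add]
    · simp
    · intro t ht
      have ht := Finset.mem_range.1 ht
      simp [show t - 2 * m = 0 by omega]
  have h2 : ∑ t ∈ Finset.range (m + 2 * m), ((m - 1 - t : ℕ) : ℝ) = m * (m - 1) / 2 := by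
    have h : ∑ t ∈ Finset.range (2 * m), ((m - 1 - (m + t) : ℕ) : ℝ) = 0 :=
      Finset.sum_eq_zero fun t _ => by simp [show m - 1 - (m + t) = 0 by omega]
    rw [Finset.sum_range_add, ← sum_range_cast, Finset.sum_range_reflect (fun t => (t : ℝ)), h,
      add_zero]
  simp only [lineWeight, if_true]
  push_cast
  rw [show 2 * m + m = 3 * m by ring] at h1
  rw [show m + 2 * m = 3 * m by ring] at h2
  rw [Finset.sum_add_distrib, Finset.sum_add_distrib, h1, h2]
  simp
  ring

/-- The total weight of the triangle. -/
theorem edgeSum_one {m : ℕ} (hm : 0 < m) :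
    edgeSum m (fun _ _ _ _ _ _ => 1) = 15 * (m : ℝ) ^ 2 + 3 * m := by
  simp only [edgeSum, ← Finset.sum_mul]
  have h1 : ∀ N ≤ 2 * m, ∑ c ∈ Finset.range N, ∑ t ∈ Finset.range (3 * m - (c + 1)),
      lineWeight m (c + 1) t = N * (3 * m) - N * (N + 1) / 2 := by
    intro N hN
    induction N with
    | zero => simp
    | succ N ih =>
      rw [Finset.sum_range_succ, ih (by omega)]
      simp only [lineWeight, Nat.add_eq_zero_iff, one_ne_zero, and_false, if_false, hN, if_true]
      rw [Finset.sum_const, Finset.card_range, nsmul_one, Nat.cast_sub (by omega)]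
      push_cast
      ring
  -- One direction: m² + 2m on the side and 4m² - m on the lines at levels 1 to 2m.
  have h2 : ∑ c ∈ Finset.range (3 * m), ∑ t ∈ Finset.range (3 * m - c), lineWeight m c t
      = 5 * (m : ℝ) ^ 2 + m := by
    rw [← Finset.sum_range_add_sum_Ico _ (show 2 * m + 1 ≤ 3 * m by omega),
      Finset.sum_range_succ', h1 _ le_rfl, Nat.sub_zero, sum_lineWeight_zero,
      Finset.sum_eq_zero]
    · push_cast; ring
    · intro c hc
      have hc := Finset.mem_Ico.1 hc
      refine Finset.sum_eq_zero fun t _ => ?_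
      rw [lineWeight, if_neg (by omega), if_neg (by omega)]
  rw [h2]
  ring

/-! ### Triangle weights in line coordinates -/

/-- By this symmetry, `triangleWeight_eq` is needed for one direction of edges only. -/
theorem triangleWeight_comp (n : ℕ) (σ : Equiv.Perm (Fin 3)) (x y : Fin 3 → ℕ) :
    triangleWeight n (x ∘ σ) (y ∘ σ) = triangleWeight n x y := by
  have h1 : (∀ i, 3 * (x ∘ σ) i ≤ 2 * n ∧ 3 * (y ∘ σ) i ≤ 2 * n) ↔
      ∀ i, 3 * x i ≤ 2 * n ∧ 3 * y i ≤ 2 * n :=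
    σ.forall_congr_left.trans (by simp)
  have h2 : ∀ i, cornerWeight n i (x ∘ σ) (y ∘ σ) = cornerWeight n (σ i) x y := by
    intro i
    have h3 : (∃ j, (x ∘ σ) j = 0 ∧ (y ∘ σ) j = 0) ↔ ∃ j, x j = 0 ∧ y j = 0 :=
      σ.exists_congr_left.trans (by simp)
    simp only [cornerWeight, h3]
    rfl
  simp only [triangleWeight, h1, h2]
  rw [Equiv.sum_comp σ (fun i => cornerWeight n i x y)]

theorem triangleWeight_eq {m c t u : ℕ} (hs : c + t + u + 1 = 3 * m) :
    triangleWeight (3 * m) ![c, t, u + 1] ![c, t + 1, u]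
      = 1 / (2 * ((3 * m : ℕ) : ℝ)) * lineWeight m c t := by
  have hj : (∃ j, ![c, t, u + 1] j = 0 ∧ ![c, t + 1, u] j = 0) ↔ c = 0 := by
    simp [Fin.exists_fin_succ]
  have hH : (∀ i, 3 * ![c, t, u + 1] i ≤ 2 * (3 * m) ∧ 3 * ![c, t + 1, u] i ≤ 2 * (3 * m)) ↔
      c ≤ 2 * m ∧ t + 1 ≤ 2 * m ∧ u + 1 ≤ 2 * m := by
    simp [Fin.forall_fin_succ]; omega
  have hw : ∀ i p q, ![c, t, u + 1] i = p → ![c, t + 1, u] i = q →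
      cornerWeight (3 * m) i ![c, t, u + 1] ![c, t + 1, u] =
        if 2 * m ≤ p ∧ 2 * m ≤ q then
          if c = 0 then ((max p q : ℕ) - 2 * (m : ℝ)) * (1 / (2 * ((3 * m : ℕ) : ℝ)))
          else if p = q then 0 else 1 / (2 * ((3 * m : ℕ) : ℝ))
        else 0 := by
    rintro i p q rfl rfl
    have e1 : ∀ x, 2 * (3 * m) ≤ 3 * x ↔ 2 * m ≤ x := fun x => by omega
    have e2 : 2 * ((3 * m : ℕ) : ℝ) / 3 = 2 * m := by push_cast; ring
    simp only [cornerWeight, hj, e1, e2]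
  simp only [triangleWeight, hH, Fin.sum_univ_three]
  rw [hw 0 c c rfl rfl, hw 1 t (t + 1) rfl rfl, hw 2 (u + 1) u rfl rfl, lineWeight]
  -- The edge lies in the hexagon, or strictly beyond level 2m at e¹ (weight 0), or in the corner at
  -- e², or in the corner at e³.
  by_cases h1 : c ≤ 2 * m ∧ t + 1 ≤ 2 * m ∧ u + 1 ≤ 2 * m
  · rw [if_pos h1]
    split_ifs with h2 h3
    · rw [show 1 + (t - 2 * m) + (m - 1 - t) = 1 by omega]; simp
    · simp
    · omega
  rw [if_neg h1]
  by_cases h2 : 2 * m < c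
  · rw [if_pos (show 2 * m ≤ c ∧ 2 * m ≤ c by omega), if_neg (show c ≠ 0 by omega), if_pos rfl,
      if_neg (show ¬ (2 * m ≤ t ∧ 2 * m ≤ t + 1) by omega),
      if_neg (show ¬ (2 * m ≤ u + 1 ∧ 2 * m ≤ u) by omega),
      if_neg (show c ≠ 0 by omega), if_neg (show ¬ c ≤ 2 * m by omega)]
    simp
  have h0 : (if 2 * m ≤ c ∧ 2 * m ≤ c then if c = 0 then
      ((max c c : ℕ) - 2 * (m : ℝ)) * (1 / (2 * ((3 * m : ℕ) : ℝ)))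
      else if c = c then 0 else 1 / (2 * ((3 * m : ℕ) : ℝ)) else 0) = 0 := by
    split_ifs <;> first | rfl | omega
  rw [h0, if_pos (show c ≤ 2 * m by omega)]
  by_cases h3 : 2 * m ≤ t
  · rw [if_pos (show 2 * m ≤ t ∧ 2 * m ≤ t + 1 by omega), if_neg (show ¬ t = t + 1 by omega),
      if_neg (show ¬ (2 * m ≤ u + 1 ∧ 2 * m ≤ u) by omega), max_eq_right (show t ≤ t + 1 by omega)]
    split_ifs with h4
    · rw [show 1 + (t - 2 * m) + (m - 1 - t) = t + 1 - 2 * m by omega, Nat.cast_sub (by omega)]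
      push_cast
      ring
    · ring
  · rw [if_neg (show ¬ (2 * m ≤ t ∧ 2 * m ≤ t + 1) by omega),
      if_pos (show 2 * m ≤ u + 1 ∧ 2 * m ≤ u by omega), if_neg (show ¬ u + 1 = u by omega),
      max_eq_left (show u ≤ u + 1 by omega)]
    split_ifs with h4
    · rw [show 1 + (t - 2 * m) + (m - 1 - t) = u + 1 - 2 * m by omega, Nat.cast_sub (by omega)]
      push_cast
      ring
    · ring

/-! ### Faces of the simplex and their edges -/

/-- The face of the simplex spanned by a set of three indices. -/
abbrev Face (k : ℕ) : Type := {S : Finset (Fin k) // S.card = 3}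

/-- The indices of a face in increasing order. -/
def Face.idx {k : ℕ} (S : Face k) : Fin 3 ↪o Fin k := S.1.orderEmbOfFin S.2

theorem Face.mem_iff {k : ℕ} (S : Face k) (l : Fin k) : l ∈ S.1 ↔ ∃ j, S.idx j = l := by
  have h := Finset.range_orderEmbOfFin S.1 S.2
  rw [← Finset.mem_coe, ← h]
  rfl

/-- The vector with the entries `a`, `b`, `c` at the indices of a face. -/
def Face.vec {k : ℕ} (S : Face k) (x : Fin 3 → ℕ) (l : Fin k) : ℕ :=
  ∑ j, if S.idx j = l then x j else 0

theorem Face.vec_idx {k : ℕ} (S : Face k) (x : Fin 3 → ℕ) (j : Fin 3) :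
    S.vec x (S.idx j) = x j := by
  simp [Face.vec, S.idx.injective.eq_iff]

theorem Face.vec_of_notMem {k : ℕ} (S : Face k) (x : Fin 3 → ℕ) {l : Fin k} (h : l ∉ S.1) :
    S.vec x l = 0 := by
  refine Finset.sum_eq_zero fun j _ => if_neg fun e => h ?_
  exact (S.mem_iff l).2 ⟨j, e⟩

theorem Face.sum_eq {k : ℕ} (S : Face k) {M : Type*} [AddCommMonoid M] (f : Fin k → M)
    (h : ∀ l, l ∉ S.1 → f l = 0) : ∑ l, f l = f (S.idx 0) + f (S.idx 1) + f (S.idx 2) := by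
  rw [← Fin.sum_univ_three (fun j => f (S.idx j)), ← Finset.sum_subset (Finset.subset_univ S.1)
    (fun l _ hl => h l hl), ← Finset.image_orderEmbOfFin_univ S.1 S.2,
    Finset.sum_image (fun a _ b _ e => (S.1.orderEmbOfFin S.2).injective e)]
  rfl

/-- The point of the grid with coordinates `a`, `b`, `c` on a face; junk unless they sum
to `n`. -/
noncomputable def Face.pt {k : ℕ} (S : Face k) (n a b c : ℕ) : Grid k n :=
  if h : a + b + c = n then
    ⟨S.vec ![a, b, c], by
      rw [S.sum_eq _ fun l => S.vec_of_notMem _]; simpa [Face.vec_idx] using h⟩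
  else Grid.vertex k n (S.idx 0)

theorem Face.pt_val {k n : ℕ} (S : Face k) {a b c : ℕ} (h : a + b + c = n) :
    (S.pt n a b c).1 = S.vec ![a, b, c] := by
  rw [Face.pt, dif_pos h]

theorem Face.pt_idx {k n : ℕ} (S : Face k) {a b c : ℕ} (h : a + b + c = n) (j : Fin 3) :
    (S.pt n a b c).1 (S.idx j) = ![a, b, c] j := by
  rw [S.pt_val h, S.vec_idx]

theorem Face.pt_inj {k n : ℕ} (S : Face k) {a b c a' b' c' : ℕ} (h : a + b + c = n)
    (h' : a' + b' + c' = n) (e : S.pt n a b c = S.pt n a' b' c') : a = a' ∧ b = b' ∧ c = c' := by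
  have := fun j => (S.pt_idx h j).symm.trans ((congrArg (fun x => x.1 (S.idx j)) e).trans
    (S.pt_idx h' j))
  exact ⟨this 0, this 1, this 2⟩

theorem Face.supp_pt {k n : ℕ} (S : Face k) {a b c : ℕ} (h : a + b + c = n) :
    (S.pt n a b c).supp ⊆ S.1 := by
  intro l hl
  by_contra hS
  have hl : (S.pt n a b c).1 l ≠ 0 := by simpa [Grid.supp] using hl
  rw [S.pt_val h, S.vec_of_notMem _ hS] at hl
  exact hl rfl

theorem Grid.eq_zero_of_supp {k n : ℕ} {x : Grid k n} {s : Finset (Fin k)} (h : x.supp ⊆ s)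
    {l : Fin k} (hl : l ∉ s) : x.1 l = 0 := by
  by_contra h0
  exact hl (h (by simpa [Grid.supp] using h0))

theorem Face.exists_pt {k n : ℕ} (S : Face k) (x : Grid k n) (hx : x.supp ⊆ S.1) :
    ∃ a b c, a + b + c = n ∧ x = S.pt n a b c := by
  have hs : x.1 (S.idx 0) + x.1 (S.idx 1) + x.1 (S.idx 2) = n := by
    rw [← S.sum_eq _ fun l => Grid.eq_zero_of_supp hx, x.2]
  refine ⟨_, _, _, hs, Subtype.ext (funext fun l => ?_)⟩
  rw [S.pt_val hs]
  by_cases hl : l ∈ S.1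
  · obtain ⟨j, rfl⟩ := (S.mem_iff l).1 hl
    rw [S.vec_idx]
    fin_cases j <;> rfl
  · rw [S.vec_of_notMem _ hl, Grid.eq_zero_of_supp hx hl]

theorem Face.vertex_eq {k n : ℕ} (S : Face k) :
    Grid.vertex k n (S.idx 0) = S.pt n n 0 0 ∧ Grid.vertex k n (S.idx 1) = S.pt n 0 n 0 ∧
      Grid.vertex k n (S.idx 2) = S.pt n 0 0 n := by
  refine ⟨?_, ?_, ?_⟩ <;> refine Subtype.ext (funext fun l => ?_) <;>
    rw [S.pt_val (by simp), Grid.vertex, Face.vec, Fin.sum_univ_three] <;>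
    simp [Pi.single_apply, eq_comm]

theorem Face.l1dist_pt {k n : ℕ} (S : Face k) {a b c a' b' c' : ℕ} (h : a + b + c = n)
    (h' : a' + b' + c' = n) :
    l1dist (S.pt n a b c).point (S.pt n a' b' c').point
      = ((|(a : ℤ) - a'| + |(b : ℤ) - b'| + |(c : ℤ) - c'| : ℤ) : ℝ) / n := by
  rw [l1dist, S.sum_eq]
  · simp only [Grid.point, S.pt_idx h, S.pt_idx h', ← sub_div, abs_div, Nat.abs_cast]
    push_cast
    simp [add_div]
  · intro l hl
    simp [Grid.point, Grid.eq_zero_of_supp (S.supp_pt h) hl,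
      Grid.eq_zero_of_supp (S.supp_pt h') hl]

theorem Face.adj_pt {k n : ℕ} (hn : 0 < n) (S : Face k) {a b c a' b' c' : ℕ} (h : a + b + c = n)
    (h' : a' + b' + c' = n) :
    (gridGraph k n).Adj (S.pt n a b c) (S.pt n a' b' c') ↔
      ((a : ℤ) - a').natAbs + ((b : ℤ) - b').natAbs + ((c : ℤ) - c').natAbs = 2 := by
  have hn' : (n : ℝ) ≠ 0 := by positivity
  have h2 : l1dist (S.pt n a b c).point (S.pt n a' b' c').point = 2 / n ↔
      ((a : ℤ) - a').natAbs + ((b : ℤ) - b').natAbs + ((c : ℤ) - c').natAbs = 2 := by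
    rw [S.l1dist_pt h h', div_left_inj' hn']
    simp only [Int.abs_eq_natAbs]
    exact_mod_cast Iff.rfl
  simp only [gridGraph, h2]
  refine and_iff_right_of_imp fun h3 e => ?_
  obtain ⟨rfl, rfl, rfl⟩ := S.pt_inj h h' e
  simp at h3

/-- The point of a face with the coordinates `x`, `y`, `z` at the positions `i`, `i + 1`,
`i + 2`. -/
noncomputable def Face.dirPt {k : ℕ} (S : Face k) (n : ℕ) (i : Fin 3) (x y z : ℕ) : Grid k n :=
  match i with
  | 0 => S.pt n x y z
  | 1 => S.pt n z x y
  | 2 => S.pt n y z x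

/-- The edge in direction `i` at position `t` of the line `x_i = c`. -/
noncomputable def Face.edge {k : ℕ} (S : Face k) (n : ℕ) (i : Fin 3) (c t : ℕ) :
    Sym2 (Grid k n) :=
  s(S.dirPt n i c t (n - c - t), S.dirPt n i c (t + 1) (n - c - t - 1))

/-- The index set of the edges of a face. -/
def edgeIndex (n : ℕ) : Finset (Fin 3 × (Σ _ : ℕ, ℕ)) :=
  Finset.univ ×ˢ (Finset.range n).sigma fun c => Finset.range (n - c)

theorem mem_edgeIndex {n : ℕ} {i : Fin 3} {c t : ℕ} :
    (i, (⟨c, t⟩ : Σ _ : ℕ, ℕ)) ∈ edgeIndex n ↔ c + t < n := by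
  simp only [edgeIndex, Finset.mem_product, Finset.mem_univ, true_and, Finset.mem_sigma,
    Finset.mem_range]
  omega

/-- The coordinate that stays constant gives i and c, and t is the smaller value of the next
coordinate, whichever endpoint comes first. -/
theorem Face.edge_inj {k n : ℕ} (S : Face k) {i i' : Fin 3} {c t c' t' : ℕ} (hp : c + t < n)
    (hp' : c' + t' < n) (h : S.edge n i c t = S.edge n i' c' t') : i = i' ∧ c = c' ∧ t = t' := by
  have h3 : ∀ i : Fin 3, i = 0 ∨ i = 1 ∨ i = 2 := by decide
  rw [Face.edge, Face.edge, Sym2.eq_iff] at h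
  rcases h with ⟨h1, h2⟩ | ⟨h1, h2⟩ <;> rcases h3 i with rfl | rfl | rfl <;>
    rcases h3 i' with rfl | rfl | rfl <;>
    · have e1 := S.pt_inj (by omega) (by omega) h1
      have e2 := S.pt_inj (by omega) (by omega) h2
      first
      | (exfalso; omega)
      | exact ⟨rfl, by omega, by omega⟩

theorem Face.edge_mem {k n : ℕ} (S : Face k) {i : Fin 3} {c t : ℕ} (hp : c + t < n) :
    S.edge n i c t ∈ (gridGraph k n).edgeSet := by
  rw [Face.edge, SimpleGraph.mem_edgeSet]
  have h3 : ∀ i : Fin 3, i = 0 ∨ i = 1 ∨ i = 2 := by decide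
  rcases h3 i with rfl | rfl | rfl <;>
    · refine (S.adj_pt (by omega) (by omega) (by omega)).2 ?_
      omega

theorem Face.exists_edge {k n : ℕ} (hn : 0 < n) (S : Face k) {x y : Grid k n}
    (h : (gridGraph k n).Adj x y) (hx : x.supp ⊆ S.1) (hy : y.supp ⊆ S.1) :
    ∃ i c t, c + t < n ∧ S.edge n i c t = s(x, y) := by
  obtain ⟨a, b, c, hs, rfl⟩ := S.exists_pt x hx
  obtain ⟨a', b', c', hs', rfl⟩ := S.exists_pt y hy
  have h := (S.adj_pt hn hs hs').1 h
  -- The differences sum to 0 and their absolute values to 2, so they are 1, -1, 0 in some order: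
  -- three directions with two orientations each.
  have key : (a = a' ∧ b' = b + 1 ∧ c = c' + 1) ∨ (a = a' ∧ b = b' + 1 ∧ c' = c + 1) ∨
      (b = b' ∧ c' = c + 1 ∧ a = a' + 1) ∨ (b = b' ∧ c = c' + 1 ∧ a' = a + 1) ∨
      (c = c' ∧ a' = a + 1 ∧ b = b' + 1) ∨ (c = c' ∧ a = a' + 1 ∧ b' = b + 1) := by
    have ha : a = a' ∨ a = a' + 1 ∨ a' = a + 1 := by omega
    have hb : b = b' ∨ b = b' + 1 ∨ b' = b + 1 := by omega
    rcases ha with rfl | rfl | rfl <;> rcases hb with rfl | rfl | rfl <;> omega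
  rcases key with h | h | h | h | h | h
  · refine ⟨0, a, b, by omega, Sym2.eq_iff.2 (Or.inl ⟨?_, ?_⟩)⟩ <;>
      simp only [Face.dirPt] <;> congr 1 <;> omega
  · refine ⟨0, a, b', by omega, Sym2.eq_iff.2 (Or.inr ⟨?_, ?_⟩)⟩ <;>
      simp only [Face.dirPt] <;> congr 1 <;> omega
  · refine ⟨1, b, c, by omega, Sym2.eq_iff.2 (Or.inl ⟨?_, ?_⟩)⟩ <;>
      simp only [Face.dirPt] <;> congr 1 <;> omega
  · refine ⟨1, b, c', by omega, Sym2.eq_iff.2 (Or.inr ⟨?_, ?_⟩)⟩ <;>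
      simp only [Face.dirPt] <;> congr 1 <;> omega
  · refine ⟨2, c, a, by omega, Sym2.eq_iff.2 (Or.inl ⟨?_, ?_⟩)⟩ <;>
      simp only [Face.dirPt] <;> congr 1 <;> omega
  · refine ⟨2, c, a', by omega, Sym2.eq_iff.2 (Or.inr ⟨?_, ?_⟩)⟩ <;>
      simp only [Face.dirPt] <;> congr 1 <;> omega

theorem faceWeight_mk {k n : ℕ} (S : Face k) (x y : Grid k n) :
    faceWeight k n S s(x, y) = if x.supp ⊆ S.1 ∧ y.supp ⊆ S.1 then
      triangleWeight n (fun j => x.1 (S.idx j)) (fun j => y.1 (S.idx j)) else 0 := rfl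

theorem faceWeight_pt {k n : ℕ} (S : Face k) {a b c a' b' c' : ℕ} (h : a + b + c = n)
    (h' : a' + b' + c' = n) : faceWeight k n S s(S.pt n a b c, S.pt n a' b' c')
      = triangleWeight n ![a, b, c] ![a', b', c'] := by
  rw [faceWeight_mk, if_pos ⟨S.supp_pt h, S.supp_pt h'⟩]
  simp only [S.pt_idx h, S.pt_idx h']

theorem faceWeight_edge {k m : ℕ} (S : Face k) (i : Fin 3) {c t : ℕ} (hp : c + t < 3 * m) :
    faceWeight k (3 * m) S (S.edge (3 * m) i c t)
      = 1 / (2 * ((3 * m : ℕ) : ℝ)) * lineWeight m c t := by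
  obtain ⟨u, hu⟩ : ∃ u, c + t + u + 1 = 3 * m := ⟨3 * m - c - t - 1, by omega⟩
  have hu1 : 3 * m - c - t = u + 1 := by omega
  rw [Face.edge, hu1, Nat.add_sub_cancel, ← triangleWeight_eq hu]
  have h3 : ∀ i : Fin 3, i = 0 ∨ i = 1 ∨ i = 2 := by decide
  rcases h3 i with rfl | rfl | rfl
  · exact faceWeight_pt S (by omega) (by omega)
  · rw [← triangleWeight_comp _ (Equiv.subRight 1)]
    refine (faceWeight_pt S (by omega) (by omega)).trans ?_
    congr 1 <;> (funext j; fin_cases j <;> rfl)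
  · rw [← triangleWeight_comp _ (Equiv.subRight 2)]
    refine (faceWeight_pt S (by omega) (by omega)).trans ?_
    congr 1 <;> (funext j; fin_cases j <;> rfl)

open scoped Classical in
/-- The embedded weights as a weighted sum over the edges of the triangle. -/
theorem sum_faceWeight_mul {k m : ℕ} (hm : 0 < m) (S : Face k) (h : Sym2 (Grid k (3 * m)) → ℝ) :
    ∑ e ∈ (gridGraph k (3 * m)).edgeFinset, faceWeight k (3 * m) S e * h e
      = 1 / (2 * ((3 * m : ℕ) : ℝ)) * edgeSum m (fun a b c a' b' c' =>
        h s(S.pt (3 * m) a b c, S.pt (3 * m) a' b' c')) := by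
  have h1 := Finset.sum_of_injOn (s := edgeIndex (3 * m))
    (fun p => S.edge (3 * m) p.1 p.2.1 p.2.2)
    (t := (gridGraph k (3 * m)).edgeFinset)
    (f := fun p => 1 / (2 * ((3 * m : ℕ) : ℝ)) * lineWeight m p.2.1 p.2.2
      * h (S.edge (3 * m) p.1 p.2.1 p.2.2))
    (g := fun e => faceWeight k (3 * m) S e * h e)
    (by
      rintro ⟨i, c, t⟩ hp ⟨i', c', t'⟩ hp' he
      obtain ⟨rfl, rfl, rfl⟩ := S.edge_inj (mem_edgeIndex.1 (Finset.mem_coe.1 hp))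
        (mem_edgeIndex.1 (Finset.mem_coe.1 hp')) he
      rfl)
    (by
      rintro ⟨i, c, t⟩ hp
      simpa using S.edge_mem (mem_edgeIndex.1 (Finset.mem_coe.1 hp)))
    -- An edge not of the form `S.edge` has an endpoint off the face, hence weight 0.
    (fun e => by
      induction e using Sym2.ind with | _ x y => ?_
      intro he hn
      rw [faceWeight_mk, if_neg, zero_mul]
      rintro ⟨hx, hy⟩
      obtain ⟨i, c, t, hp, hpe⟩ := S.exists_edge (by omega) (by simpa using he) hx hy
      exact hn ⟨(i, ⟨c, t⟩), Finset.mem_coe.2 (mem_edgeIndex.2 hp), hpe⟩)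
    (by
      rintro ⟨i, c, t⟩ hp
      rw [faceWeight_edge S i (mem_edgeIndex.1 hp)])
  rw [← h1, edgeIndex, Finset.sum_product, Fin.sum_univ_three, ← Finset.sum_add_distrib,
    ← Finset.sum_add_distrib, Finset.sum_sigma, edgeSum, Finset.mul_sum]
  refine Finset.sum_congr rfl fun c _ => ?_
  rw [Finset.mul_sum]
  refine Finset.sum_congr rfl fun t _ => ?_
  simp only [Face.edge, Face.dirPt]
  ring

/-! ### Averaging over faces and the canonical value -/

theorem triangleWeight_nonneg (n : ℕ) (x y : Fin 3 → ℕ) : 0 ≤ triangleWeight n x y := by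
  have hρ : (0 : ℝ) ≤ 1 / (2 * (n : ℝ)) := by positivity
  unfold triangleWeight
  split_ifs
  · exact hρ
  · refine Finset.sum_nonneg fun i _ => ?_
    unfold cornerWeight
    split_ifs with h1
    · refine mul_nonneg (sub_nonneg.2 ?_) hρ
      have h2 : 2 * n ≤ 3 * max (x i) (y i) := by omega
      have h3 : 2 * (n : ℝ) ≤ 3 * ((max (x i) (y i) : ℕ) : ℝ) := by exact_mod_cast h2
      linarith
    · exact le_rfl
    · exact hρ
    · exact le_rfl

theorem faceWeight_nonneg {k n : ℕ} (S : Face k) (e : Sym2 (Grid k n)) :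
    0 ≤ faceWeight k n S e := by
  induction e using Sym2.ind with | _ x y => ?_
  rw [faceWeight_mk]
  split_ifs
  · exact triangleWeight_nonneg _ _ _
  · exact le_rfl

theorem averageWeight_nonneg {k n : ℕ} (e : Sym2 (Grid k n)) : 0 ≤ averageWeight k n e :=
  div_nonneg (Finset.sum_nonneg fun S _ => faceWeight_nonneg S e) (Nat.cast_nonneg _)

theorem card_face (k : ℕ) : Fintype.card (Face k) = k.choose 3 := by
  simp

theorem sum_averageWeight_mul {k n : ℕ} (E : Finset (Sym2 (Grid k n))) (h : Sym2 (Grid k n) → ℝ) :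
    ∑ e ∈ E, averageWeight k n e * h e
      = (∑ S : Face k, ∑ e ∈ E, faceWeight k n S e * h e) / (k.choose 3 : ℝ) := by
  rw [Finset.sum_comm, Finset.sum_div]
  refine Finset.sum_congr rfl fun e _ => ?_
  rw [averageWeight, ← Finset.sum_mul]
  ring

theorem ckrValue_averageWeight {k n : ℕ} (u : Grid k n → Fin k → ℝ) :
    ckrValue (gridGraph k n) (averageWeight k n) u
      = (∑ S : Face k, ckrValue (gridGraph k n) (faceWeight k n S) u) / (k.choose 3 : ℝ) :=
  sum_averageWeight_mul _ _

theorem cutCost_averageWeight {k n : ℕ} (P : Grid k n → Fin k) :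
    cutCost (gridGraph k n) (averageWeight k n) P
      = (∑ S : Face k, cutCost (gridGraph k n) (faceWeight k n S) P) / (k.choose 3 : ℝ) :=
  sum_averageWeight_mul _ _

theorem cutCost_nonneg {k : ℕ} {V : Type*} [Fintype V] (G : SimpleGraph V) {w : Sym2 V → ℝ}
    (hw : ∀ e, 0 ≤ w e) (P : V → Fin k) : 0 ≤ cutCost G w P :=
  Finset.sum_nonneg fun e _ => mul_nonneg (hw e) (by split_ifs <;> norm_num)

/-- Every edge has length 1/n, so the value is (15m² + 3m) / (6m · 3m). -/
theorem canonicalLP_faceWeight {k m : ℕ} (hm : 0 < m) (S : Face k) :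
    canonicalLP k (3 * m) (faceWeight k (3 * m) S) = 5 / 6 + 1 / (6 * m) := by
  classical
  have hm' : (m : ℝ) ≠ 0 := by positivity
  have h1 := sum_faceWeight_mul hm S (fun _ => 1 / ((3 * m : ℕ) : ℝ) * 1)
  rw [edgeSum_const_mul, edgeSum_one hm] at h1
  rw [canonicalLP, ckrValue]
  refine (Finset.sum_congr rfl fun e he => ?_).trans (h1.trans ?_)
  · congr 1
    have he := SimpleGraph.mem_edgeFinset.1 he
    induction e using Sym2.ind with | _ x y => ?_
    have h2 : l1dist x.point y.point = 2 / ((3 * m : ℕ) : ℝ) := (SimpleGraph.mem_edgeSet _).1 he |>.2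
    simp only [ckrLength, Sym2.lift_mk, h2]
    ring
  · push_cast
    field_simp
    ring

theorem canonicalLP_averageWeight {k m : ℕ} (hm : 0 < m) (hk : 3 ≤ k) :
    canonicalLP k (3 * m) (averageWeight k (3 * m)) = 5 / 6 + 1 / (6 * m) := by
  have h := fun S : Face k => canonicalLP_faceWeight hm S
  have hc : (k.choose 3 : ℝ) ≠ 0 := by exact_mod_cast (Nat.choose_pos hk).ne'
  simp only [canonicalLP] at h ⊢
  rw [ckrValue_averageWeight, Finset.sum_congr rfl fun S _ => h S, Finset.sum_const,
    Finset.card_univ, card_face, nsmul_eq_mul, mul_div_cancel_left₀ _ hc]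

/-! ### Cost of cuts of the simplex -/

/-- The cut `P` assigns no point of a side of the face to the opposite vertex of the face. -/
def NonOpposite {k n : ℕ} (P : Grid k n → Fin k) (S : Face k) : Prop :=
  ∀ a b, a + b = n → P (S.pt n 0 a b) ≠ S.idx 0 ∧ P (S.pt n a 0 b) ≠ S.idx 1 ∧
    P (S.pt n a b 0) ≠ S.idx 2

theorem one_le_cutCost_faceWeight {k m : ℕ} (hm : 0 < m) (S : Face k)
    {P : Grid k (3 * m) → Fin k} (hP : IsKWayCut (Grid.vertex k (3 * m)) P)
    (hS : NonOpposite P S) : 1 ≤ cutCost (gridGraph k (3 * m)) (faceWeight k (3 * m) S) P := by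
  classical
  have hm' : (0 : ℝ) < m := by exact_mod_cast hm
  have hi : ∀ i j, i ≠ j → S.idx i ≠ S.idx j := fun i j h e => h (S.idx.injective e)
  obtain ⟨v0, v1, v2⟩ := S.vertex_eq (n := 3 * m)
  have h1 := edgeSum_ne_ge hm (fun a b c => P (S.pt (3 * m) a b c)) (hi 0 1 (by decide))
    (hi 0 2 (by decide)) (hi 1 2 (by decide)) (by rw [← v0, hP]) (by rw [← v1, hP])
    (by rw [← v2, hP]) (fun b c h => (hS b c h).1) (fun a c h => (hS a c h).2.1)
    (fun a b h => (hS a b h).2.2)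
  rw [cutCost, sum_faceWeight_mul hm S]
  simp only [Sym2.map_mk, Sym2.mk_isDiag_iff]
  have h2 : 1 / (2 * ((3 * m : ℕ) : ℝ)) * (6 * m) = 1 := by
    push_cast
    field_simp
    norm_num
  calc (1 : ℝ) = 1 / (2 * ((3 * m : ℕ) : ℝ)) * (6 * m) := h2.symm
    _ ≤ _ := by
      refine mul_le_mul_of_nonneg_left (h1.trans (le_of_eq ?_)) (by positivity)
      congr!

/-- The grid point on the edge of the simplex between the `p`-th and the `q`-th vertex. -/
def Grid.onEdge {k n : ℕ} (p q : Fin k) (a : Fin (n + 1)) : Grid k n :=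
  ⟨Pi.single p a.1 + Pi.single q (n - a.1), by
    simp [Finset.sum_add_distrib]; omega⟩

theorem Face.pt_eq_onEdge {k n : ℕ} (S : Face k) {a b : ℕ} (h : a + b = n) :
    S.pt n 0 a b = Grid.onEdge (S.idx 1) (S.idx 2) ⟨a, by omega⟩ ∧
    S.pt n a 0 b = Grid.onEdge (S.idx 0) (S.idx 2) ⟨a, by omega⟩ ∧
    S.pt n a b 0 = Grid.onEdge (S.idx 0) (S.idx 1) ⟨a, by omega⟩ := by
  have hb : n - a = b := by omega
  refine ⟨?_, ?_, ?_⟩ <;> refine Subtype.ext (funext fun l => ?_) <;>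
    rw [S.pt_val (by omega), Grid.onEdge, Face.vec, Fin.sum_univ_three] <;>
    simp [Pi.single_apply, eq_comm, hb]

theorem Face.eq_triple {k : ℕ} (S : Face k) : S.1 = {S.idx 0, S.idx 1, S.idx 2} := by
  ext l
  rw [S.mem_iff]
  simp [Fin.exists_fin_succ, eq_comm]

open scoped Classical in
/-- Few faces have a side with a point that is assigned to the opposite vertex. -/
theorem card_opposite_le {k n : ℕ} (P : Grid k n → Fin k) :
    (Finset.univ.filter fun S : Face k => ¬ NonOpposite P S).card ≤ k ^ 2 * (n + 1) := by
  let ψ : Fin k × Fin k × Fin (n + 1) → Finset (Fin k) :=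
    fun z => {z.1, z.2.1, P (Grid.onEdge z.1 z.2.1 z.2.2)}
  have h1 : (Finset.univ.filter fun S : Face k => ¬ NonOpposite P S).map
      (Function.Embedding.subtype _) ⊆ Finset.univ.image ψ := by
    intro T hT
    obtain ⟨(S : Face k), hS, rfl⟩ := Finset.mem_map.1 hT
    have hS := (Finset.mem_filter.1 hS).2
    simp only [NonOpposite, not_forall] at hS
    obtain ⟨a, b, hab, hS⟩ := hS
    obtain ⟨e0, e1, e2⟩ := S.pt_eq_onEdge hab
    rw [e0, e1, e2] at hS
    refine Finset.mem_image.2 ?_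
    simp only [Finset.mem_univ, true_and, Function.Embedding.subtype_apply]
    rw [S.eq_triple]
    by_cases h0 : P (Grid.onEdge (S.idx 1) (S.idx 2) ⟨a, by omega⟩) = S.idx 0
    · exact ⟨(S.idx 1, S.idx 2, ⟨a, by omega⟩), by
        ext l; simp only [ψ, h0, Finset.mem_insert, Finset.mem_singleton]; tauto⟩
    by_cases h1 : P (Grid.onEdge (S.idx 0) (S.idx 2) ⟨a, by omega⟩) = S.idx 1
    · exact ⟨(S.idx 0, S.idx 2, ⟨a, by omega⟩), by
        ext l; simp only [ψ, h1, Finset.mem_insert, Finset.mem_singleton]; tauto⟩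
    by_cases h2 : P (Grid.onEdge (S.idx 0) (S.idx 1) ⟨a, by omega⟩) = S.idx 2
    · exact ⟨(S.idx 0, S.idx 1, ⟨a, by omega⟩), by
        ext l; simp only [ψ, h2, Finset.mem_insert, Finset.mem_singleton]⟩
    exact absurd ⟨h0, h1, h2⟩ hS
  have h2 := (Finset.card_le_card h1).trans Finset.card_image_le
  rw [Finset.card_map] at h2
  refine h2.trans (le_of_eq ?_)
  simp
  ring

/-- The binomial is at least (k-2)³/6, and k-2 ≥ k/3; hence 162 = 6 · 27. -/
theorem cube_le_choose {k : ℕ} (hk : 3 ≤ k) : (k : ℝ) ^ 3 ≤ 162 * (k.choose 3 : ℝ) := by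
  have h := Nat.pow_le_choose (α := ℝ) 3 k
  have h1 : (k : ℝ) / 3 ≤ ((k + 1 - 3 : ℕ) : ℝ) := by
    rw [div_le_iff₀ (by norm_num)]
    exact_mod_cast (by omega : k ≤ (k + 1 - 3) * 3)
  have h2 : ((k : ℝ) / 3) ^ 3 ≤ ((k + 1 - 3 : ℕ) : ℝ) ^ 3 := by gcongr
  have h3 : ((Nat.factorial 3 : ℕ) : ℝ) = 6 := by norm_num [Nat.factorial]
  rw [h3] at h
  linarith

/-- Bad faces are counted with cost 0. The constant is 2 · 162, where the factor 2 comes from n + 1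
≤ 2n. -/
theorem cutCost_averageWeight_ge {k m : ℕ} (hm : 0 < m) (hk : 3 ≤ k)
    {P : Grid k (3 * m) → Fin k} (hP : IsKWayCut (Grid.vertex k (3 * m)) P) :
    1 - 324 * (((3 * m : ℕ) : ℝ) / k) ≤
      cutCost (gridGraph k (3 * m)) (averageWeight k (3 * m)) P := by
  classical
  have hc : (0 : ℝ) < k.choose 3 := by exact_mod_cast Nat.choose_pos hk
  have hk' : (0 : ℝ) < k := by exact_mod_cast (by omega : 0 < k)
  have h1 : ∀ S : Face k, 1 - (if ¬ NonOpposite P S then 1 else 0 : ℝ) ≤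
      cutCost (gridGraph k (3 * m)) (faceWeight k (3 * m) S) P := by
    intro S
    by_cases h : NonOpposite P S
    · simpa [h] using one_le_cutCost_faceWeight hm S hP h
    · simpa [h] using cutCost_nonneg _ (faceWeight_nonneg S) P
  have h2 := Finset.sum_le_sum fun S (_ : S ∈ Finset.univ) => h1 S
  rw [Finset.sum_sub_distrib, Finset.sum_boole, Finset.sum_const, Finset.card_univ, card_face,
    nsmul_one] at h2
  have h3 : ((Finset.univ.filter fun S : Face k => ¬ NonOpposite P S).card : ℝ) ≤
      (k : ℝ) ^ 2 * (((3 * m : ℕ) : ℝ) + 1) := by exact_mod_cast card_opposite_le P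
  have h4 : (1 : ℝ) ≤ ((3 * m : ℕ) : ℝ) := by exact_mod_cast (by omega : 1 ≤ 3 * m)
  have h5 : (k : ℝ) ^ 2 * (((3 * m : ℕ) : ℝ) + 1) ≤
      324 * (((3 * m : ℕ) : ℝ) / k) * (k.choose 3 : ℝ) := by
    calc (k : ℝ) ^ 2 * (((3 * m : ℕ) : ℝ) + 1) ≤ (k : ℝ) ^ 2 * (2 * ((3 * m : ℕ) : ℝ)) := by
          gcongr; linarith
      _ = 2 * (((3 * m : ℕ) : ℝ) / k) * (k : ℝ) ^ 3 := by field_simp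
      _ ≤ 2 * (((3 * m : ℕ) : ℝ) / k) * (162 * (k.choose 3 : ℝ)) := by
          gcongr; exact cube_le_choose hk
      _ = _ := by ring
  rw [cutCost_averageWeight, le_div_iff₀ hc, sub_mul, one_mul]
  linarith

/-! ### Bounds on the relaxation and the integrality gap -/

/-- A function with different values at two corners varies along the paths between them. -/
theorem one_le_totalVar {m : ℕ} (hm : 0 < m) (f : ℕ → ℕ → ℕ → ℝ) (h1 : f (3 * m) 0 0 = 1)
    (h3 : f 0 0 (3 * m) = 0) : 1 ≤ totalVar m f := by
  refine le_trans ?_ (totalVar_ge hm f)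
  have hp : ∀ d ∈ Finset.Icc 1 m, 1 ≤ pathVar m f d + pathVar m (rotate f) d
      + pathVar m (rotate (rotate f)) d := by
    intro d hd
    have hd := Finset.mem_Icc.1 hd
    have h := lineVar_ge_ends m (rotate f) (show d ≤ 3 * m by omega)
    have e0 := pathVar_nonneg m f d
    have e2 := pathVar_nonneg m (rotate (rotate f)) d
    have e1 : 1 ≤ pathVar m (rotate f) d := by
      rw [pathVar]
      simp only [rotate] at h ⊢
      rw [h1, h3]
      have a1 := le_abs_self (1 - f (3 * m - d) d 0)
      have a2 := neg_abs_le (0 - f 0 d (3 * m - d))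
      have a3 := (le_abs_self _).trans h
      linarith
    linarith
  have h := Finset.sum_le_sum hp
  rw [Finset.sum_const, Nat.card_Icc, Nat.add_sub_cancel, nsmul_one] at h
  have hm' : (1 : ℝ) ≤ m := by exact_mod_cast hm
  have h0 : 0 ≤ ∑ d ∈ Finset.Icc 1 m, (lineVar m f (m + d) + lineVar m (rotate f) (m + d)
        + lineVar m (rotate (rotate f)) (m + d)) :=
    Finset.sum_nonneg fun d _ => add_nonneg (add_nonneg (lineVar_nonneg _ _ _)
      (lineVar_nonneg _ _ _)) (lineVar_nonneg _ _ _)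
  have hs1 := sideVar_nonneg m f
  have hs2 := sideVar_nonneg m (rotate f)
  have hs3 := sideVar_nonneg m (rotate (rotate f))
  linarith

/-- One coordinate of `u` already varies by 1 between two corners. The bound is crude, but it serves
only for positivity and for boundedness below of the infimum. -/
theorem ckrValue_faceWeight_ge {k m : ℕ} (hm : 0 < m) (S : Face k)
    {u : Grid k (3 * m) → Fin k → ℝ} (hu : IsCKRFeasible (Grid.vertex k (3 * m)) u) :
    1 / (12 * (m : ℝ)) ≤ ckrValue (gridGraph k (3 * m)) (faceWeight k (3 * m) S) u := by
  have hm' : (0 : ℝ) < m := by exact_mod_cast hm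
  obtain ⟨v0, -, v2⟩ := S.vertex_eq (n := 3 * m)
  have h1 := one_le_totalVar hm (fun a b c => u (S.pt (3 * m) a b c) (S.idx 0))
    (by rw [← v0, hu.2]; simp)
    (by rw [← v2, hu.2, Pi.single_eq_of_ne]; exact fun e => by simpa using S.idx.injective e)
  rw [← edgeSum_abs] at h1
  rw [ckrValue, sum_faceWeight_mul hm S]
  have h2 := edgeSum_le_edgeSum (m := m)
    (D := fun a b c a' b' c' => 1 / 2 * |u (S.pt (3 * m) a b c) (S.idx 0)
      - u (S.pt (3 * m) a' b' c') (S.idx 0)|)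
    (D' := fun a b c a' b' c' => ckrLength u s(S.pt (3 * m) a b c, S.pt (3 * m) a' b' c'))
    (fun a b c a' b' c' _ _ _ _ _ _ _ _ => by
      simp only [ckrLength, Sym2.lift_mk]
      refine mul_le_mul_of_nonneg_left ?_ (by norm_num)
      exact Finset.single_le_sum (f := fun i => |u (S.pt (3 * m) a b c) i
        - u (S.pt (3 * m) a' b' c') i|) (fun _ _ => abs_nonneg _) (Finset.mem_univ _))
  rw [edgeSum_const_mul] at h2
  calc 1 / (12 * (m : ℝ)) = 1 / (2 * ((3 * m : ℕ) : ℝ)) * (1 / 2 * 1) := by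
        push_cast; field_simp; norm_num
    _ ≤ _ := mul_le_mul_of_nonneg_left (by linarith) (by positivity)

theorem ckrValue_averageWeight_ge {k m : ℕ} (hm : 0 < m) (hk : 3 ≤ k)
    {u : Grid k (3 * m) → Fin k → ℝ} (hu : IsCKRFeasible (Grid.vertex k (3 * m)) u) :
    1 / (12 * (m : ℝ)) ≤ ckrValue (gridGraph k (3 * m)) (averageWeight k (3 * m)) u := by
  have hc : (0 : ℝ) < k.choose 3 := by exact_mod_cast Nat.choose_pos hk
  have h := Finset.sum_le_sum fun S (_ : S ∈ (Finset.univ : Finset (Face k))) =>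
    ckrValue_faceWeight_ge hm S hu
  rw [Finset.sum_const, Finset.card_univ, card_face, nsmul_eq_mul] at h
  rw [ckrValue_averageWeight, le_div_iff₀ hc]
  linarith

theorem isCKRFeasible_point {k n : ℕ} (hn : 0 < n) :
    IsCKRFeasible (Grid.vertex k n) (Grid.point : Grid k n → Fin k → ℝ) := by
  have hn' : (n : ℝ) ≠ 0 := by positivity
  refine ⟨fun v => ?_, fun i => ?_⟩
  · have h : (Grid.point v : Fin k → ℝ) ∈ Set.range (Grid.point : Grid k n → Fin k → ℝ) := ⟨v, rfl⟩
    rw [Grid.range_point hn] at h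
    exact h.1
  · funext j
    simp only [Grid.point, Grid.vertex, Pi.single_apply]
    split_ifs
    · exact div_self hn'
    · simp

theorem exists_isKWayCut {k n : ℕ} (hn : 0 < n) (hk : 0 < k) :
    ∃ P : Grid k n → Fin k, IsKWayCut (Grid.vertex k n) P := by
  have : Nonempty (Fin k) := ⟨⟨0, hk⟩⟩
  have hinj : Function.Injective (Grid.vertex k n) := by
    intro i j h
    have h1 := congrFun (congrArg Subtype.val h) i
    by_contra hij
    simp only [Grid.vertex, Pi.single_eq_same, Pi.single_eq_of_ne hij] at h1
    omega
  exact ⟨Function.invFun (Grid.vertex k n), Function.leftInverse_invFun hinj⟩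

theorem ckrOpt_pos {k m : ℕ} (hm : 0 < m) (hk : 3 ≤ k) :
    0 < ckrOpt (gridGraph k (3 * m)) (Grid.vertex k (3 * m)) (averageWeight k (3 * m)) := by
  have hm' : (0 : ℝ) < m := by exact_mod_cast hm
  refine lt_of_lt_of_le (show (0 : ℝ) < 1 / (12 * (m : ℝ)) by positivity) ?_
  refine le_csInf ⟨_, Grid.point, isCKRFeasible_point (by omega), rfl⟩ ?_
  rintro _ ⟨u, hu, rfl⟩
  exact ckrValue_averageWeight_ge hm hk hu

theorem ckrOpt_le {k m : ℕ} (hm : 0 < m) (hk : 3 ≤ k) :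
    ckrOpt (gridGraph k (3 * m)) (Grid.vertex k (3 * m)) (averageWeight k (3 * m))
      ≤ 5 / 6 + 1 / (6 * m) := by
  rw [← canonicalLP_averageWeight hm hk]
  refine csInf_le ⟨1 / (12 * (m : ℝ)), ?_⟩ ⟨_, isCKRFeasible_point (by omega), rfl⟩
  rintro _ ⟨u, hu, rfl⟩
  exact ckrValue_averageWeight_ge hm hk hu

theorem le_cutOpt {k n : ℕ} (hn : 0 < n) (hk : 0 < k) {w : Sym2 (Grid k n) → ℝ} {r : ℝ}
    (h : ∀ P, IsKWayCut (Grid.vertex k n) P → r ≤ cutCost (gridGraph k n) w P) :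
    r ≤ cutOpt (gridGraph k n) (Grid.vertex k n) w := by
  obtain ⟨P, hP⟩ := exists_isKWayCut (n := n) hn hk
  refine le_csInf ⟨_, P, hP, rfl⟩ ?_
  rintro _ ⟨Q, hQ, rfl⟩
  exact h Q hQ

theorem mainTheorem9 :
    ∃ C : ℝ, 0 < C ∧
      (∀ n k : ℕ, 0 < n → 3 ∣ n → 3 ≤ k →
        (∀ e ∈ (gridGraph k n).edgeSet, 0 ≤ averageWeight k n e) ∧
        canonicalLP k n (averageWeight k n) ≤ 5 / 6 + C / n ∧
        ∀ P : Grid k n → Fin k, IsKWayCut (Grid.vertex k n) P →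
          1 - C * ((n : ℝ) / k) ≤ cutCost (gridGraph k n) (averageWeight k n) P) ∧
      (∀ n k : ℕ, 0 < n → 3 ∣ n → 3 ≤ k → |(n : ℝ) - Real.sqrt k| < 3 →
        0 < ckrOpt (gridGraph k n) (Grid.vertex k n) (averageWeight k n) ∧
        6 / 5 - C / Real.sqrt k ≤
          integralityGap (gridGraph k n) (Grid.vertex k n) (averageWeight k n)) := by
  -- 1944 = 3 · 648 and 648 = 2 · 324: with n ≤ 2√k the cut loses at most ε = 648/√k, and the
  -- quotient loses at most 3ε.
  refine ⟨1944, by norm_num, ?_, ?_⟩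
  · rintro n k hn ⟨m, rfl⟩ hk
    have hm : 0 < m := by omega
    have hm' : (0 : ℝ) < m := by exact_mod_cast hm
    refine ⟨fun e _ => averageWeight_nonneg e, ?_, fun P hP => ?_⟩
    · rw [canonicalLP_averageWeight hm hk]
      have h : 1 / (6 * (m : ℝ)) ≤ 1944 / ((3 * m : ℕ) : ℝ) := by
        push_cast
        rw [div_le_div_iff₀ (by positivity) (by positivity)]
        linarith
      linarith
    · refine le_trans ?_ (cutCost_averageWeight_ge hm hk hP)
      have : 0 ≤ ((3 * m : ℕ) : ℝ) / k := by positivity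
      linarith
  · rintro n k hn ⟨m, rfl⟩ hk hs
    have hm : 0 < m := by omega
    have hpos := ckrOpt_pos hm hk
    refine ⟨hpos, ?_⟩
    have hle := ckrOpt_le hm hk
    have hcut : 1 - 324 * (((3 * m : ℕ) : ℝ) / k) ≤ cutOpt (gridGraph k (3 * m))
        (Grid.vertex k (3 * m)) (averageWeight k (3 * m)) :=
      le_cutOpt hn (by omega) fun P hP => cutCost_averageWeight_ge hm hk hP
    have hcut0 : 0 ≤ cutOpt (gridGraph k (3 * m))
        (Grid.vertex k (3 * m)) (averageWeight k (3 * m)) :=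
      le_cutOpt hn (by omega) fun P _ => cutCost_nonneg _ averageWeight_nonneg P
    rw [integralityGap, le_div_iff₀ hpos]
    have hk0 : (0 : ℝ) < k := by exact_mod_cast (by omega : 0 < k)
    set s := Real.sqrt k with hsdef
    have hs0 : 0 < s := Real.sqrt_pos.2 hk0
    have hss : s * s = k := Real.mul_self_sqrt hk0.le
    obtain ⟨hs1, hs2⟩ := abs_lt.1 hs
    -- For small k the claimed bound is nonpositive and holds trivially. Otherwise √k > 6, which
    -- gives n ≤ 2√k.
    by_cases hneg : 6 / 5 - 1944 / s ≤ 0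
    · exact (mul_nonpos_of_nonpos_of_nonneg hneg hpos.le).trans hcut0
    push Not at hneg
    have hs6 : 6 < s := by
      by_contra! h
      have : 1944 / 6 ≤ 1944 / s := by gcongr
      linarith
    have h1 : 1 / (6 * (m : ℝ)) ≤ 648 / s := by
      push_cast at hs1
      rw [div_le_div_iff₀ (by positivity) hs0]
      linarith
    have h2 : 324 * (((3 * m : ℕ) : ℝ) / k) ≤ 648 / s := by
      rw [← hss, ← mul_div_assoc, div_le_div_iff₀ (by positivity) hs0]
      have : ((3 * m : ℕ) : ℝ) * s ≤ 2 * s * s := by gcongr; linarith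
      linarith
    have h3 : 1944 / s = 3 * (648 / s) := by ring
    have h4 : 0 < 648 / s := by positivity
    rw [h3] at hneg ⊢
    generalize 648 / s = ε at *
    -- The product is 1 - (13/10)ε - 3ε².
    calc (6 / 5 - 3 * ε) * _ ≤ (6 / 5 - 3 * ε) * (5 / 6 + ε) :=
          mul_le_mul_of_nonneg_left (by linarith) hneg.le
      _ ≤ 1 - ε := by nlinarith [sq_nonneg ε]
      _ ≤ _ := by linarith
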